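/- **Setting.** Points of $\mathbb R^d$ are taken with the Euclidean norm, balls $B_R(y)$ are closed, and $\mathrm{Vol}$ is Lebesgue measure. A *Delone multiset* in $\mathbb R^d$ is a family $\mathbf\Lambda=(\Lambda_i)_{i\le m}$ of subsets of $\mathbb R^d$ such that each $\Lambda_i$ and $\mathrm{supp}(\mathbf\Lambda)=\bigcup_i\Lambda_i$ are Delone (uniformly discrete and relatively dense). Translations, inclusions, and intersections with subsets of $\mathbb R^d$ are understood colour by colour. A *cluster* of $\mathbf\Lambda$ is a family $\mathbf P=(P_i)_{i\le m}$ of finite sets $P_i\subset\Lambda_i$; it is *nonempty* if some $P_i\neq\emptyset$. * $\mathbf\Lambda$ has *finite local complexity* (FLC) if for every $R>0$ there is a finite $Y\subset\mathrm{supp}(\mathbf\Lambda)$ such that for all $x\in\mathrm{supp}(\mathbf\Lambda)$ there is $y\in Y$ with $B_R(x)\cap\mathbf\Lambda=(B_R(y)\cap\mathbf\Lambda)+(x-y)$. * A *van Hove sequence* is a sequence $(F_n)$ of bounded measurable subsets of $\mathbb R^d$ of positive volume such that $\mathrm{Vol}((\partial F_n)^{+r})/\mathrm{Vol}(F_n)\to0$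 for all $r>0$, where $S^{+r}$ is the set of points at distance at most $r$ from $S$. * For a nonempty cluster $\mathbf P$ and bounded $A\subset\mathbb R^d$ let $L_{\mathbf P}(A)=\#\{x\in\mathbb R^d: x+\mathbf P\subset A\cap\mathbf\Lambda\}$. $\mathbf\Lambda$ has *uniform cluster frequencies* (UCF) relative to $(F_n)$ if for every nonempty cluster $\mathbf P$ of $\mathbf\Lambda$ the limit $\mathrm{freq}(\mathbf P,\mathbf\Lambda)=\lim_{n\to\infty}L_{\mathbf P}(x+F_n)/\mathrm{Vol}(F_n)$ exists uniformly in $x\in\mathbb R^d$ (it does not depend on $x$). * On Delone multisets put $d(\mathbf\Gamma_1,\mathbf\Gamma_2)=\min\{\tilde d(\mathbf\Gamma_1,\mathbf\Gamma_2),2^{-1/2}\}$, where $\tilde d(\mathbf\Gamma_1,\mathbf\Gamma_2)$ is the infimum of all $\varepsilon>0$ for which there are $x,y\in B_\varepsilon(0)$ with $B_{1/\varepsilon}(0)\cap(-x+\mathbf\Gamma_1)=B_{1/\varepsilon}(0)\cap(-y+\mathbf\Gamma_2)$. Let $X$ be the set of Delone multisets each of whose clusters is a translate of a cluster of $\mathbf\Lambda$.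 The *hull* $X_{\mathbf\Lambda}$ is the closure of $\{-h+\mathbf\Lambda:h\in\mathbb R^d\}$ in $(X,d)$; $\mathbb R^d$ acts on it by translations. * For a cluster $\mathbf P$ and a Borel set $V\subset\mathbb R^d$ let $X_{\mathbf P,V}=\{\mathbf\Lambda'\in X_{\mathbf\Lambda}: -g+\mathbf P\subset\mathbf\Lambda'\text{ for some }g\in V\}$. **Statement.** Let $(F_n)$ be a van Hove sequence and let $\mathbf\Lambda$ be a Delone multiset in $\mathbb R^d$ that has FLC and has UCF relative to $(F_n)$. Then there is a unique translation invariant Borel probability measure $\mu$ on $X_{\mathbf\Lambda}$. Moreover, let $\eta(\mathbf\Lambda)>0$ be any number such that every ball of radius $\eta(\mathbf\Lambda)/2$ contains at most one point of $\mathrm{supp}(\mathbf\Lambda)$. Then for every nonempty cluster $\mathbf P$ of $\mathbf\Lambda$ and every Borel set $V\subset\mathbb R^d$ with $\mathrm{diam}(V)<\eta(\mathbf\Lambda)$, the set $X_{\mathbf P,V}$ is Borel in $X_{\mathbf\Lambda}$ and $$\mu(X_{\mathbf P,V})=\mathrm{Vol}(V)\cdot\mathrm{freq}(\mathbf P,\mathbf\Lambda).$$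 -/

import Mathlib

open scoped Pointwise
open Filter Topology MeasureTheory

noncomputable section

namespace DeloneDyn

/-- Euclidean space of dimension `d`, with the Euclidean norm and Lebesgue measure. -/
abbrev E (d : ℕ) : Type := EuclideanSpace ℝ (Fin d)

/-- A set is Delone if it is uniformly discrete and relatively dense. -/
def IsDelone {d : ℕ} (S : Set (E d)) : Prop :=
  ∃ D : Delone.DeloneSet (E d), D.carrier = S

lemma IsDelone.vadd {d : ℕ} {S : Set (E d)} (hS : IsDelone S) (t : E d) :
    IsDelone (t +ᵥ S) := by
  obtain ⟨D, rfl⟩ := hS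
  exact ⟨Delone.DeloneSet.mapIsometry (IsometryEquiv.addLeft t) D, rfl⟩

lemma IsDelone.isClosed {d : ℕ} {S : Set (E d)} (hS : IsDelone S) : IsClosed S := by
  obtain ⟨D, rfl⟩ := hS
  have hr : (0 : ℝ) < D.packingRadius := D.packingRadius_pos
  refine Metric.isClosed_of_pairwise_le_dist hr ?_
  intro x hx y hy hne
  exact (D.packingRadius_lt_dist_of_mem_ne hx hy hne).le

/-- A Delone multiset with `m` colours: every colour class is Delone, and so is the union
(the support). Different colour classes are allowed to intersect. -/
@[ext]
structure DeloneMultiset (d m : ℕ) where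
  /-- The set of points of each colour. -/
  pts : Fin m → Set (E d)
  isDelone_pts : ∀ i, IsDelone (pts i)
  isDelone_supp : IsDelone (⋃ i, pts i)

namespace DeloneMultiset

variable {d m : ℕ}

/-- The support: the union of all colour classes. -/
def supp (Λ : DeloneMultiset d m) : Set (E d) := ⋃ i, Λ.pts i

/-- Translation of a Delone multiset, colour by colour. -/
instance : VAdd (E d) (DeloneMultiset d m) where
  vadd t Λ :=
    { pts := fun i => t +ᵥ Λ.pts i
      isDelone_pts := fun i => (Λ.isDelone_pts i).vadd t
      isDelone_supp := by
        rw [← Set.vadd_set_iUnion]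
        exact Λ.isDelone_supp.vadd t }

@[simp] lemma vadd_pts (t : E d) (Λ : DeloneMultiset d m) (i : Fin m) :
    (t +ᵥ Λ).pts i = t +ᵥ Λ.pts i := rfl

instance : AddAction (E d) (DeloneMultiset d m) where
  zero_vadd Λ := by ext i : 2; simp
  add_vadd s t Λ := by ext i : 2; simp [add_vadd]

/-- After translations by vectors of norm at most `ε`, the two multisets
coincide in the closed ball of radius `1/ε` around the origin. -/
def Near (ε : ℝ) (Γ₁ Γ₂ : DeloneMultiset d m) : Prop :=
  ∃ x ∈ Metric.closedBall (0 : E d) ε, ∃ y ∈ Metric.closedBall (0 : E d) ε, ∀ i,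
    Metric.closedBall (0 : E d) (1 / ε) ∩ (-x +ᵥ Γ₁).pts i =
      Metric.closedBall (0 : E d) (1 / ε) ∩ (-y +ᵥ Γ₂).pts i

/-- `min (inf {ε > 0 : Near ε Γ₁ Γ₂}) 2^{-1/2}`, where the infimum of the empty set is `+∞`
(so the number `2^{-1/2}` is inserted into the set before the infimum is taken). -/
instance : Dist (DeloneMultiset d m) where
  dist Γ₁ Γ₂ := sInf (insert (1 / √2) {ε : ℝ | 0 < ε ∧ Near ε Γ₁ Γ₂})

lemma near_iff {ε : ℝ} {Γ₁ Γ₂ : DeloneMultiset d m} :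
    Near ε Γ₁ Γ₂ ↔ ∃ x y : E d, ‖x‖ ≤ ε ∧ ‖y‖ ≤ ε ∧ ∀ i, ∀ z : E d, ‖z‖ ≤ 1 / ε →
      (x + z ∈ Γ₁.pts i ↔ y + z ∈ Γ₂.pts i) := by
  simp only [Near, mem_closedBall_zero_iff, Set.ext_iff, Set.mem_inter_iff, vadd_pts,
    Set.mem_vadd_set_iff_neg_vadd_mem, neg_neg, vadd_eq_add, and_congr_right_iff]
  constructor
  · rintro ⟨x, hx, y, hy, h⟩
    exact ⟨x, y, hx, hy, h⟩
  · rintro ⟨x, y, hx, hy, h⟩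
    exact ⟨x, hx, y, hy, h⟩

lemma Near.symm {ε : ℝ} {Γ₁ Γ₂ : DeloneMultiset d m} (h : Near ε Γ₁ Γ₂) : Near ε Γ₂ Γ₁ := by
  obtain ⟨x, hx, y, hy, h⟩ := h
  exact ⟨y, hy, x, hx, fun i => (h i).symm⟩

lemma Near.refl {ε : ℝ} (hε : 0 < ε) (Γ : DeloneMultiset d m) : Near ε Γ Γ :=
  ⟨0, by simp [hε.le], 0, by simp [hε.le], fun _ => rfl⟩

lemma Near.mono {ε ε' : ℝ} {Γ₁ Γ₂ : DeloneMultiset d m} (h : Near ε Γ₁ Γ₂) (hε : 0 < ε)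
    (hle : ε ≤ ε') : Near ε' Γ₁ Γ₂ := by
  rw [near_iff] at h ⊢
  obtain ⟨x, y, hx, hy, h⟩ := h
  exact ⟨x, y, hx.trans hle, hy.trans hle, fun i z hz =>
    h i z (hz.trans (one_div_le_one_div_of_le hε hle))⟩

lemma Near.trans {a b : ℝ} (ha : 0 < a) (hb : 0 < b) (hab : a + b ≤ 1 / √2)
    {Γ₁ Γ₂ Γ₃ : DeloneMultiset d m} (h₁ : Near a Γ₁ Γ₂) (h₂ : Near b Γ₂ Γ₃) :
    Near (a + b) Γ₁ Γ₃ := by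
  rw [near_iff] at h₁ h₂ ⊢
  obtain ⟨x, y, hx, hy, h⟩ := h₁
  obtain ⟨x', y', hx', hy', h'⟩ := h₂
  have hsq : (a + b) ^ 2 ≤ 1 / 2 := by
    have h0 : (1 / √2) ^ 2 = (1 / 2 : ℝ) := by
      rw [div_pow, Real.sq_sqrt (by norm_num)]; norm_num
    rw [← h0]
    gcongr
  have key : ∀ u v : ℝ, 0 < u → 0 < v → (u + v) ^ 2 ≤ 1 / 2 →
      v + 1 / (u + v) ≤ 1 / u := by
    intro u v hu hv huv
    have e : 1 / u - (v + 1 / (u + v)) = v * (1 - u * (u + v)) / (u * (u + v)) := by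
      field_simp
      ring
    have h1 : 0 ≤ 1 - u * (u + v) := by nlinarith
    have : 0 ≤ v * (1 - u * (u + v)) / (u * (u + v)) := by positivity
    linarith
  refine ⟨x + x', y + y', (norm_add_le _ _).trans (by gcongr),
    (norm_add_le _ _).trans (by gcongr), fun i z hz => ?_⟩
  have h1 : ‖x' + z‖ ≤ 1 / a :=
    ((norm_add_le _ _).trans (add_le_add hx' hz)).trans (key a b ha hb hsq)
  have h2 : ‖y + z‖ ≤ 1 / b := by
    refine ((norm_add_le _ _).trans (add_le_add hy hz)).trans ?_
    rw [add_comm a b]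
    exact key b a hb ha (by rwa [add_comm])
  rw [add_assoc, h i _ h1, show y + (x' + z) = x' + (y + z) by abel, h' i _ h2,
    show y' + (y + z) = y + y' + z by abel]

lemma bddBelow_distSet (Γ₁ Γ₂ : DeloneMultiset d m) :
    BddBelow (insert (1 / √2) {ε : ℝ | 0 < ε ∧ Near ε Γ₁ Γ₂}) := by
  refine ⟨0, ?_⟩
  rintro ε (rfl | h)
  · positivity
  · exact h.1.le

lemma distFun_nonneg (Γ₁ Γ₂ : DeloneMultiset d m) : 0 ≤ dist Γ₁ Γ₂ := by
  refine le_csInf (Set.insert_nonempty _ _) ?_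
  rintro ε (rfl | h)
  · positivity
  · exact h.1.le

lemma distFun_le (Γ₁ Γ₂ : DeloneMultiset d m) : dist Γ₁ Γ₂ ≤ 1 / √2 :=
  csInf_le (bddBelow_distSet Γ₁ Γ₂) (Set.mem_insert _ _)

lemma Near.distFun_le {ε : ℝ} {Γ₁ Γ₂ : DeloneMultiset d m} (h : Near ε Γ₁ Γ₂) (hε : 0 < ε) :
    dist Γ₁ Γ₂ ≤ ε :=
  csInf_le (bddBelow_distSet Γ₁ Γ₂) (Set.mem_insert_of_mem _ ⟨hε, h⟩)

lemma near_of_distFun_lt {ε : ℝ} {Γ₁ Γ₂ : DeloneMultiset d m} (h : dist Γ₁ Γ₂ < ε)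
    (hε : ε ≤ 1 / √2) : Near ε Γ₁ Γ₂ := by
  obtain ⟨r, hr, hlt⟩ := exists_lt_of_csInf_lt (Set.insert_nonempty _ _) h
  rcases hr with rfl | hr
  · exact absurd hlt (not_lt.mpr hε)
  · exact hr.2.mono hr.1 hlt.le

lemma subset_of_distFun_eq_zero {Γ₁ Γ₂ : DeloneMultiset d m} (h : dist Γ₁ Γ₂ = 0) (i : Fin m) :
    Γ₁.pts i ⊆ Γ₂.pts i := by
  intro p hp
  rw [← (Γ₂.isDelone_pts i).isClosed.closure_eq, Metric.mem_closure_iff]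
  intro δ hδ
  have h2 : (0 : ℝ) < 1 / √2 := by positivity
  obtain ⟨r, hr0, hr⟩ : ∃ r : ℝ, 0 < r ∧ r ≤ 1 / √2 ∧ 2 * r < δ ∧ r ≤ 1 ∧
      ‖p‖ + 1 ≤ 1 / r := by
    have hp1 : 0 < ‖p‖ + 1 := by positivity
    refine ⟨min (1 / √2) (min (δ / 3) (min 1 (1 / (‖p‖ + 1)))), by positivity,
      min_le_left _ _, ?_, ?_, ?_⟩
    · have : min (1 / √2) (min (δ / 3) (min 1 (1 / (‖p‖ + 1)))) ≤ δ / 3 :=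
        (min_le_right _ _).trans (min_le_left _ _)
      linarith
    · exact (min_le_right _ _).trans ((min_le_right _ _).trans (min_le_left _ _))
    · rw [le_div_iff₀ (by positivity), mul_comm, ← le_div_iff₀ hp1]
      exact (min_le_right _ _).trans ((min_le_right _ _).trans (min_le_right _ _))
  obtain ⟨hr1, hr2, hr3, hr4⟩ := hr
  obtain ⟨x, y, hx, hy, hxy⟩ := near_iff.mp (near_of_distFun_lt (by rw [h]; exact hr0) hr1)
  have hz : ‖p - x‖ ≤ 1 / r := by
    have := norm_sub_le p x
    linarith
  refine ⟨y + (p - x), (hxy i _ hz).mp (by simpa using hp), ?_⟩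
  rw [dist_eq_norm, show p - (y + (p - x)) = x - y by abel]
  have := norm_sub_le x y
  linarith

instance : MetricSpace (DeloneMultiset d m) where
  dist_self Γ := by
    refine le_antisymm (le_of_forall_pos_le_add fun ε hε => ?_) (distFun_nonneg _ _)
    simpa using (Near.refl hε Γ).distFun_le hε
  dist_comm Γ₁ Γ₂ := by
    have : ∀ ε : ℝ, Near ε Γ₁ Γ₂ ↔ Near ε Γ₂ Γ₁ := fun ε => ⟨Near.symm, Near.symm⟩
    simp only [dist, this]
  dist_triangle Γ₁ Γ₂ Γ₃ := by
    by_cases hbig : 1 / √2 ≤ dist Γ₁ Γ₂ + dist Γ₂ Γ₃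
    · exact (distFun_le _ _).trans hbig
    push Not at hbig
    refine le_of_forall_pos_le_add fun ε hε => ?_
    have n1 := distFun_nonneg Γ₁ Γ₂
    have n2 := distFun_nonneg Γ₂ Γ₃
    obtain ⟨δ, hδ0, hδ1, hδ2⟩ : ∃ δ : ℝ, 0 < δ ∧ 2 * δ ≤ ε ∧
        2 * δ ≤ 1 / √2 - (dist Γ₁ Γ₂ + dist Γ₂ Γ₃) := by
      refine ⟨min ε (1 / √2 - (dist Γ₁ Γ₂ + dist Γ₂ Γ₃)) / 2, ?_, ?_, ?_⟩
      · have : 0 < min ε (1 / √2 - (dist Γ₁ Γ₂ + dist Γ₂ Γ₃)) :=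
          lt_min hε (by linarith)
        linarith
      · have := min_le_left ε (1 / √2 - (dist Γ₁ Γ₂ + dist Γ₂ Γ₃))
        linarith
      · have := min_le_right ε (1 / √2 - (dist Γ₁ Γ₂ + dist Γ₂ Γ₃))
        linarith
    have h1 : Near (dist Γ₁ Γ₂ + δ) Γ₁ Γ₂ := near_of_distFun_lt (by linarith) (by linarith)
    have h2 : Near (dist Γ₂ Γ₃ + δ) Γ₂ Γ₃ := near_of_distFun_lt (by linarith) (by linarith)
    have h3 := (h1.trans (by linarith) (by linarith) (by linarith) h2).distFun_le (by linarith)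
    linarith
  eq_of_dist_eq_zero := by
    intro Γ₁ Γ₂ h
    have h' : dist Γ₂ Γ₁ = 0 := by
      have : ∀ ε : ℝ, Near ε Γ₁ Γ₂ ↔ Near ε Γ₂ Γ₁ := fun ε => ⟨Near.symm, Near.symm⟩
      rw [← h]
      simp only [dist, this]
    ext i : 2
    exact (subset_of_distFun_eq_zero h i).antisymm (subset_of_distFun_eq_zero h' i)

instance : MeasurableSpace (DeloneMultiset d m) := borel _

instance : BorelSpace (DeloneMultiset d m) := ⟨rfl⟩

instance : ContinuousConstVAdd (E d) (DeloneMultiset d m) where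
  continuous_const_vadd t := by
    rw [Metric.continuous_iff]
    intro Γ ε hε
    have h2 : (0 : ℝ) < 1 / √2 := by positivity
    set e := min (ε / 2) (1 / √2) with he
    have he0 : 0 < e := by positivity
    have hpos : 0 < 1 / e + ‖t‖ := by positivity
    have hδe : 1 / (1 / e + ‖t‖) ≤ e := by
      rw [div_le_iff₀ hpos, mul_add, mul_one_div_cancel he0.ne']
      have : 0 ≤ e * ‖t‖ := by positivity
      linarith
    refine ⟨1 / (1 / e + ‖t‖), by positivity, fun Γ' h => ?_⟩
    obtain ⟨x, y, hx, hy, hxy⟩ :=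
      near_iff.mp (near_of_distFun_lt h (hδe.trans (min_le_right _ _)))
    have hn : Near e (t +ᵥ Γ') (t +ᵥ Γ) := by
      rw [near_iff]
      refine ⟨x, y, hx.trans hδe, hy.trans hδe, fun i z hz => ?_⟩
      have hz' : ‖z - t‖ ≤ 1 / (1 / (1 / e + ‖t‖)) := by
        rw [one_div_one_div]
        exact (norm_sub_le _ _).trans (by gcongr)
      have := hxy i (z - t) hz'
      simp only [vadd_pts, Set.mem_vadd_set_iff_neg_vadd_mem, vadd_eq_add]
      rwa [show -t + (x + z) = x + (z - t) by abel, show -t + (y + z) = y + (z - t) by abel]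
    have h3 := hn.distFun_le he0
    have h4 : e ≤ ε / 2 := min_le_left _ _
    linarith

end DeloneMultiset

variable {d m : ℕ}

/-- `P` is a cluster of `Λ`: a family of finite sets `P i ⊆ Λ i`. -/
def IsCluster (P : Fin m → Set (E d)) (Λ : DeloneMultiset d m) : Prop :=
  ∀ i, (P i).Finite ∧ P i ⊆ Λ.pts i

/-- Finite local complexity. -/
def HasFLC (Λ : DeloneMultiset d m) : Prop :=
  ∀ R : ℝ, 0 < R → ∃ Y : Set (E d), Y.Finite ∧ Y ⊆ Λ.supp ∧ ∀ x ∈ Λ.supp, ∃ y ∈ Y, ∀ i,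
    Metric.closedBall x R ∩ Λ.pts i = (x - y) +ᵥ (Metric.closedBall y R ∩ Λ.pts i)

/-- The Delone multisets each of whose clusters is a translate of a cluster of `Λ`. -/
def localClass (Λ : DeloneMultiset d m) : Set (DeloneMultiset d m) :=
  {Γ | ∀ P, IsCluster P Γ → ∃ (x : E d) (Q : Fin m → Set (E d)),
    IsCluster Q Λ ∧ ∀ i, P i = x +ᵥ Q i}

/-- The hull of `Λ`: the closure of the translation orbit of `Λ` inside `localClass Λ`. -/
def hull (Λ : DeloneMultiset d m) : Set (DeloneMultiset d m) :=
  localClass Λ ∩ closure (Set.range fun h : E d => -h +ᵥ Λ)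

lemma vadd_mem_localClass {Λ Γ : DeloneMultiset d m} (hΓ : Γ ∈ localClass Λ) (t : E d) :
    t +ᵥ Γ ∈ localClass Λ := by
  intro P hP
  obtain ⟨x, Q, hQ, h⟩ := hΓ (fun i => -t +ᵥ P i) fun i =>
    ⟨(hP i).1.vadd_set, by
      have := (hP i).2
      rw [DeloneMultiset.vadd_pts, Set.subset_vadd_set_iff] at this
      exact this⟩
  refine ⟨t + x, Q, hQ, fun i => ?_⟩
  rw [add_vadd, ← h i, vadd_neg_vadd]

lemma vadd_mem_hull {Λ Γ : DeloneMultiset d m} (hΓ : Γ ∈ hull Λ) (t : E d) :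
    t +ᵥ Γ ∈ hull Λ := by
  refine ⟨vadd_mem_localClass hΓ.1 t, ?_⟩
  refine map_mem_closure (continuous_const_vadd t) hΓ.2 ?_
  rintro _ ⟨h, rfl⟩
  refine ⟨h - t, ?_⟩
  change -(h - t) +ᵥ Λ = t +ᵥ (-h +ᵥ Λ)
  rw [← add_vadd, neg_sub, sub_eq_add_neg]

/-- The translation action on the hull. The hull carries the metric and the Borel
sigma-algebra inherited from `DeloneMultiset d m`. -/
instance (Λ : DeloneMultiset d m) : AddAction (E d) (hull Λ) where
  vadd t Γ := ⟨t +ᵥ Γ.1, vadd_mem_hull Γ.2 t⟩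
  zero_vadd Γ := Subtype.ext (zero_vadd _ Γ.1)
  add_vadd s t Γ := Subtype.ext (add_vadd s t Γ.1)

/-- The cylinder set of all `Γ` in the hull with `-g + P ⊆ Γ` for some `g ∈ V`. -/
def cylinder (Λ : DeloneMultiset d m) (P : Fin m → Set (E d)) (V : Set (E d)) :
    Set (hull Λ) :=
  {Γ | ∃ g ∈ V, ∀ i, -g +ᵥ P i ⊆ Γ.1.pts i}

/-- The number of vectors `x` such that `x + P ⊆ A ∩ Λ`; this number is finite if
`A` is bounded and `P` is a nonempty cluster. -/
def clusterCount (Λ : DeloneMultiset d m) (P : Fin m → Set (E d)) (A : Set (E d)) : ℕ :=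
  {x : E d | ∀ i, x +ᵥ P i ⊆ A ∩ Λ.pts i}.ncard

/-- Van Hove sequences of bounded Lebesgue measurable sets of positive volume;
`Metric.cthickening r S` is the set of all points at distance at most `r` from `S`. -/
structure IsVanHove (F : ℕ → Set (E d)) : Prop where
  isBounded : ∀ n, Bornology.IsBounded (F n)
  measurable : ∀ n, NullMeasurableSet (F n)
  volume_pos : ∀ n, 0 < volume (F n)
  tendsto : ∀ r : ℝ, 0 < r → Tendsto
    (fun n => volume (Metric.cthickening r (frontier (F n))) / volume (F n)) atTop (𝓝 0)

/-- The frequency of `P` in `Λ` relative to `F` (meaningful if the limit exists). -/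
def freq (F : ℕ → Set (E d)) (Λ : DeloneMultiset d m) (P : Fin m → Set (E d)) : ℝ :=
  limUnder atTop fun n => (clusterCount Λ P (F n) : ℝ) / volume.real (F n)

/-- Uniform cluster frequencies relative to `F`: for every nonempty cluster `P` of `Λ`,
the numbers `clusterCount Λ P (x + F n) / Vol (F n)` converge as `n → ∞`, uniformly in `x`.
(The limit does not depend on `x`, so it is `freq F Λ P`.) -/
def HasUCF (F : ℕ → Set (E d)) (Λ : DeloneMultiset d m) : Prop :=
  ∀ P : Fin m → Set (E d), IsCluster P Λ → (∃ i, (P i).Nonempty) → TendstoUniformly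
    (fun (n : ℕ) (x : E d) => (clusterCount Λ P (x +ᵥ F n) : ℝ) / volume.real (F n))
    (fun _ => freq F Λ P) atTop

/-- `μ` is a translation invariant Borel probability measure on the hull. -/
def IsInvariantProb (Λ : DeloneMultiset d m) (μ : Measure (hull Λ)) : Prop :=
  IsProbabilityMeasure μ ∧ VAddInvariantMeasure (E d) (hull Λ) μ

end DeloneDyn

end

/-!
A Delone multiset lies in the hull of `Λ` exactly when each of its bounded portions is a translate
of a portion of `Λ` (`mem_hull_iff`). Finite local complexity makes the orbit of `Λ` totally
bounded (`totallyBounded_orbit`), and the hull is complete (`completeSpace_hull`) because a rapidly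
Cauchy sequence becomes locally constant after small corrections by translations. So the hull is
compact.

*Existence* is the Krylov-Bogoliubov argument: on the compact hull the averages of point masses
along the orbit, over the sets `F n`, have a cluster point, and the van Hove property makes it
invariant (`exists_invariantProb`).

*The formula.* Let `V` have diameter less than `η`. For `Γ` in the hull, the translations `t` with
`-t + Γ` in the cylinder of `P` and `V` form the disjoint union of the sets `x + V`, where `x` runs
over the vectors translating `P` into `Γ`. Up to an error supported near the frontier of `F n`, the
part of this union inside `F n` has volume `Vol V` times the number of occurrences of `P` in
`F n ∩ Γ` (`abs_volume_sub_clusterCount_le`), and the latter is a count for `Λ` in a translated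
window, hence governed by the uniform frequency. By invariance and Fubini, averaging over `F n`
does not change the measure of the cylinder, so every invariant probability measure gives it the
mass `Vol V * freq P` (`measure_cylinder`).

*Uniqueness.* Consequently two invariant measures agree on cylinders over small sets. The
intersection of two such cylinders is a countable disjoint union of cylinders of the same kind, one
for each relative position of the two patterns, so the countable disjoint unions of cylinders form
a π-system (`isPiSystem_cylinderUnions`). It generates the Borel σ-algebra, since countably many
one-point cylinders separate the points of the hull (`borel_hull_eq_generateFrom`).
-/

open scoped BoundedContinuousFunction

noncomputable section

namespace DeloneDyn

variable {d m : ℕ}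

/-! ### Local characterisation and compactness of the hull -/

lemma mem_vadd_pts {t z : E d} {Γ : DeloneMultiset d m} {i : Fin m} :
    z ∈ (t +ᵥ Γ).pts i ↔ z - t ∈ Γ.pts i := by
  rw [DeloneMultiset.vadd_pts, Set.mem_vadd_set_iff_neg_vadd_mem, vadd_eq_add, neg_add_eq_sub]

/-- Every bounded portion of the family `G` is, up to a translation, the corresponding portion
of `Λ`. -/
def LocallyLike (Λ : DeloneMultiset d m) (G : Fin m → Set (E d)) : Prop :=
  ∀ R : ℝ, ∃ h : E d, ∀ i, ∀ z : E d, ‖z‖ ≤ R → (z ∈ G i ↔ h + z ∈ Λ.pts i)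

/-- For `ε` small enough, the ball of radius `1/ε` contains the ball of radius `R`, with a margin
of `ε` for the small translations in `DeloneMultiset.Near`. -/
lemma exists_radius (R : ℝ) {δ : ℝ} (hδ : 0 < δ) :
    ∃ ε : ℝ, 0 < ε ∧ ε ≤ δ ∧ ε ≤ 1 / √2 ∧ R + ε ≤ 1 / ε := by
  have h2 : (0 : ℝ) < 1 / √2 := by positivity
  have hp1 : 0 < |R| + 1 := by positivity
  refine ⟨min (min δ (1 / √2)) (min 1 (1 / (|R| + 1))), by positivity,
    (min_le_left _ _).trans (min_le_left _ _), (min_le_left _ _).trans (min_le_right _ _), ?_⟩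
  set ε := min (min δ (1 / √2)) (min 1 (1 / (|R| + 1))) with hε
  have h0 : 0 < ε := by positivity
  have h1 : ε ≤ 1 := (min_le_right _ _).trans (min_le_left _ _)
  have h3 : ε ≤ 1 / (|R| + 1) := (min_le_right _ _).trans (min_le_right _ _)
  have h4 : |R| + 1 ≤ 1 / ε := by
    rwa [le_div_iff₀ h0, mul_comm, ← le_div_iff₀ hp1]
  have := le_abs_self R
  linarith

lemma near_of_forall {ε : ℝ} (hε : 0 < ε) {Γ₁ Γ₂ : DeloneMultiset d m} (v : E d) (hv : ‖v‖ ≤ ε)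
    (h : ∀ i, ∀ z : E d, ‖z‖ ≤ 1 / ε → (z ∈ Γ₁.pts i ↔ v + z ∈ Γ₂.pts i)) :
    DeloneMultiset.Near ε Γ₁ Γ₂ :=
  DeloneMultiset.near_iff.mpr ⟨0, v, by simpa using hε.le, hv, by simpa using h⟩

/-- The hull is described by exact coincidence on bounded sets: the small translations allowed by
the metric are absorbed into the translation of `Λ`. In particular every limit of translates of
`Λ` belongs to `localClass Λ`. -/
lemma mem_hull_iff {Λ Γ : DeloneMultiset d m} : Γ ∈ hull Λ ↔ LocallyLike Λ Γ.pts := by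
  constructor
  · rintro ⟨-, hΓ⟩ R
    obtain ⟨ε, hε, -, hε2, hR⟩ := exists_radius R one_pos
    obtain ⟨_, ⟨h, rfl⟩, hh⟩ := Metric.mem_closure_iff.mp hΓ ε hε
    obtain ⟨x, y, hx, hy, hxy⟩ :=
      DeloneMultiset.near_iff.mp (DeloneMultiset.near_of_distFun_lt hh hε2)
    refine ⟨h + y - x, fun i z hz => ?_⟩
    have h1 := hxy i (z - x) ((norm_sub_le z x).trans (by linarith))
    rw [add_sub_cancel, mem_vadd_pts] at h1
    rw [h1, show y + (z - x) - -h = h + y - x + z by abel]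
  · intro hL
    constructor
    · intro P hP
      have hb : Bornology.IsBounded (⋃ i, P i) :=
        (Set.finite_iUnion fun i => (hP i).1).isBounded
      obtain ⟨R, hR⟩ := hb.exists_norm_le
      obtain ⟨h, hh⟩ := hL R
      refine ⟨-h, fun i => h +ᵥ P i, fun i => ⟨(hP i).1.vadd_set, ?_⟩, fun i => ?_⟩
      · rintro _ ⟨z, hz, rfl⟩
        exact (hh i z (hR z (Set.mem_iUnion_of_mem i hz))).mp ((hP i).2 hz)
      · rw [neg_vadd_vadd]
    · rw [Metric.mem_closure_iff]
      intro δ hδ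
      obtain ⟨ε, hε, hεδ, -, -⟩ := exists_radius 0 (half_pos hδ)
      obtain ⟨h, hh⟩ := hL (1 / ε)
      refine ⟨_, ⟨h, rfl⟩, ?_⟩
      have hn : DeloneMultiset.Near ε Γ (-h +ᵥ Λ) :=
        near_of_forall hε 0 (by simpa using hε.le) fun i z hz => by
          rw [mem_vadd_pts, hh i z hz, zero_add, sub_neg_eq_add, add_comm]
      have := hn.distFun_le hε
      linarith

/-- Both Delone radii are inherited, as each is tested on bounded portions of the set. -/
lemma isDelone_of_locally_translate {S G : Set (E d)} (hS : IsDelone S)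
    (h : ∀ R : ℝ, ∃ h : E d, ∀ z : E d, ‖z‖ ≤ R → (z ∈ G ↔ h + z ∈ S)) : IsDelone G := by
  obtain ⟨D, rfl⟩ := hS
  refine ⟨⟨G, D.packingRadius, D.packingRadius_pos, ?_, D.coveringRadius, D.coveringRadius_pos,
    ?_⟩, rfl⟩
  · intro x hx y hy hne
    obtain ⟨t, ht⟩ := h (max ‖x‖ ‖y‖)
    have := D.isSeparated_packingRadius ((ht x (le_max_left _ _)).mp hx)
      ((ht y (le_max_right _ _)).mp hy) (by simpa using hne)
    simpa using this
  · intro x _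
    obtain ⟨t, ht⟩ := h (‖x‖ + D.coveringRadius)
    obtain ⟨y, hy, hxy⟩ := D.exists_dist_le_coveringRadius (t + x)
    have hd : dist x (y - t) = dist (t + x) y := by
      rw [dist_eq_norm, dist_eq_norm]; congr 1; abel
    refine ⟨y - t, (ht _ ?_).mpr (by simpa using hy), ?_⟩
    · have h1 : ‖y - t‖ ≤ ‖x‖ + dist x (y - t) := by
        rw [dist_eq_norm, norm_sub_rev x]
        simpa only [add_sub_cancel] using norm_add_le x (y - t - x)
      rw [hd] at h1
      linarith
    · change edist x (y - t) ≤ _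
      rw [edist_dist, hd]
      exact ENNReal.ofReal_le_of_le_toReal (by simpa using hxy)

lemma LocallyLike.exists_mem_hull {Λ : DeloneMultiset d m} {G : Fin m → Set (E d)}
    (h : LocallyLike Λ G) : ∃ Γ ∈ hull Λ, Γ.pts = G := by
  refine ⟨⟨G, fun i => ?_, ?_⟩, mem_hull_iff.mpr h, rfl⟩
  · exact isDelone_of_locally_translate (Λ.isDelone_pts i) fun R =>
      (h R).imp fun t ht => ht i
  · refine isDelone_of_locally_translate Λ.isDelone_supp fun R => (h R).imp fun t ht z hz => ?_
    simp only [Set.mem_iUnion, ht _ z hz]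

lemma dist_vadd_vadd_le (s t : E d) (Γ : DeloneMultiset d m) :
    dist (s +ᵥ Γ) (t +ᵥ Γ) ≤ dist s t := by
  rcases eq_or_ne s t with rfl | hne
  · simp
  · refine (near_of_forall (dist_pos.mpr hne) (t - s) (by rw [dist_eq_norm, norm_sub_rev])
      fun i z _ => ?_).distFun_le (dist_pos.mpr hne)
    rw [mem_vadd_pts, mem_vadd_pts, show t - s + z - t = z - s by abel]

lemma continuous_vadd_left (Γ : DeloneMultiset d m) : Continuous fun t : E d => t +ᵥ Γ :=
  (LipschitzWith.of_dist_le_mul (K := 1) fun s t => by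
    simpa using dist_vadd_vadd_le s t Γ).continuous

/-- By finite local complexity, the orbit lies in an arbitrarily small thickening of a compact
subset of itself: translating by a point of the support close to the origin reduces to
finitely many patches, seen from a bounded set of vantage points. -/
lemma totallyBounded_orbit {Λ : DeloneMultiset d m} (hΛ : HasFLC Λ) :
    TotallyBounded (Set.range fun h : E d => -h +ᵥ Λ) := by
  rw [Metric.totallyBounded_iff]
  intro δ hδ
  obtain ⟨D, hD⟩ := Λ.isDelone_supp
  obtain ⟨r, hr⟩ : ∃ r : ℝ, r = D.coveringRadius := ⟨_, rfl⟩
  obtain ⟨ε, hε, hεδ, -, -⟩ := exists_radius 0 (show 0 < δ / 4 by linarith)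
  obtain ⟨Y, hYfin, -, hY⟩ := hΛ (r + 1 / ε) (by rw [hr]; positivity)
  have hK : IsCompact ((fun h : E d => -h +ᵥ Λ) '' (Y + Metric.closedBall 0 r)) := by
    refine (hYfin.isCompact.add (isCompact_closedBall 0 r)).image ?_
    exact (continuous_vadd_left Λ).comp continuous_neg
  obtain ⟨t, ht, htc⟩ := Metric.totallyBounded_iff.mp hK.totallyBounded (δ / 2) (by linarith)
  refine ⟨t, ht, ?_⟩
  rintro _ ⟨h, rfl⟩
  obtain ⟨x, hx, hxh⟩ := D.exists_dist_le_coveringRadius h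
  have hx' : x ∈ Λ.supp := by
    rw [DeloneMultiset.supp, ← hD]; exact hx
  rw [← hr] at hxh
  obtain ⟨y, hyY, hy⟩ := hY x hx'
  have hmem : -(y + (h - x)) +ᵥ Λ ∈
      (fun h : E d => -h +ᵥ Λ) '' (Y + Metric.closedBall 0 r) :=
    ⟨_, Set.add_mem_add hyY (by simpa [← dist_eq_norm] using hxh), rfl⟩
  obtain ⟨q, hq, hlt⟩ := Set.mem_iUnion₂.mp (htc hmem)
  refine Set.mem_iUnion₂.mpr ⟨q, hq, ?_⟩
  have hn : DeloneMultiset.Near ε (-h +ᵥ Λ) (-(y + (h - x)) +ᵥ Λ) := by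
    refine near_of_forall hε 0 (by simpa using hε.le) fun i z hz => ?_
    rw [zero_add, mem_vadd_pts, mem_vadd_pts, sub_neg_eq_add, sub_neg_eq_add]
    have hb : ‖z + (h - x)‖ ≤ r + 1 / ε := by
      refine (norm_add_le _ _).trans ?_
      rw [← dist_eq_norm]
      linarith
    have := Set.ext_iff.mp (hy i) (z + h)
    rw [Set.mem_vadd_set_iff_neg_vadd_mem, Set.mem_inter_iff, Set.mem_inter_iff,
      mem_closedBall_iff_norm, mem_closedBall_iff_norm, vadd_eq_add,
      show z + h - x = z + (h - x) by abel, show -(x - y) + (z + h) - y = z + (h - x) by abel,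
      show -(x - y) + (z + h) = z + (y + (h - x)) by abel] at this
    simpa only [hb, true_and] using this
  have h1 := hn.distFun_le hε
  rw [Metric.mem_ball] at hlt ⊢
  have h2 := dist_triangle (-h +ᵥ Λ) (-(y + (h - x)) +ᵥ Λ) q
  change dist (-h +ᵥ Λ) q < δ
  linarith

/-- A rapidly Cauchy sequence in the hull becomes, after small corrections `w - w n` by
translations, locally constant; the local limits form an element of the hull. -/
lemma completeSpace_hull (Λ : DeloneMultiset d m) : CompleteSpace (hull Λ) := by
  refine Metric.complete_of_convergent_controlled_sequences (fun n => (1 / 2 : ℝ) ^ (n + 1))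
    (fun n => by positivity) fun u hu => ?_
  have hstep : ∀ n, ∃ v : E d, ‖v‖ ≤ (1 / 2) ^ n ∧ ∀ i, ∀ z : E d, ‖z‖ ≤ 2 ^ n →
      (z ∈ (u n).1.pts i ↔ v + z ∈ (u (n + 1)).1.pts i) := by
    intro n
    have h1 : dist (u n).1 (u (n + 1)).1 < (1 / 2 : ℝ) ^ (n + 1) := hu n n (n + 1) le_rfl (by simp)
    have h2 : (1 / 2 : ℝ) ^ (n + 1) ≤ 1 / √2 := by
      have : (1 / 2 : ℝ) ^ (n + 1) ≤ 1 / 2 := pow_le_of_le_one (by norm_num) (by norm_num) (by simp)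
      refine this.trans (one_div_le_one_div_of_le (by positivity) ?_)
      rw [Real.sqrt_le_left (by norm_num)]
      norm_num
    obtain ⟨x, y, hx, hy, hxy⟩ :=
      DeloneMultiset.near_iff.mp (DeloneMultiset.near_of_distFun_lt h1 h2)
    refine ⟨y - x, (norm_sub_le _ _).trans ?_, fun i z hz => ?_⟩
    · rw [pow_succ] at hx hy
      linarith
    · have h3 := hxy i (z - x) ?_
      · rw [add_sub_cancel] at h3
        rw [h3, show y + (z - x) = y - x + z by abel]
      · refine (norm_sub_le z x).trans ?_
        have h4 : 1 / (1 / 2 : ℝ) ^ (n + 1) = 2 ^ n + 2 ^ n := by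
          rw [one_div_pow, one_div_one_div, pow_succ, mul_two]
        have h5 : (1 / 2 : ℝ) ^ (n + 1) ≤ 1 := pow_le_one₀ (by norm_num) (by norm_num)
        have h6 : (1 : ℝ) ≤ 2 ^ n := one_le_pow₀ (by norm_num)
        linarith
  choose v hv hvu using hstep
  have hsum : Summable v := Summable.of_norm_bounded summable_geometric_two hv
  -- `s n` is the total correction still to be applied to `u n`
  set s : ℕ → E d := fun n => ∑' k, v (k + n) with hs
  have hs_succ : ∀ n, s n = v n + s (n + 1) := by
    intro n
    have := ((summable_nat_add_iff n).mpr hsum).tsum_eq_zero_add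
    simp only [hs, this, zero_add]
    congr 1
    exact tsum_congr fun k => by congr 1; ring
  have hs_norm : ∀ n, ‖s n‖ ≤ 2 := by
    intro n
    refine tsum_of_norm_bounded hasSum_geometric_two fun k => (hv _).trans ?_
    exact pow_le_pow_of_le_one (by norm_num) (by norm_num) (by simp)
  have hs_lim : Tendsto s atTop (𝓝 0) := tendsto_sum_nat_add v
  have hstab : ∀ n i (z : E d), ‖z‖ + 2 ≤ 2 ^ n → ∀ k, n ≤ k →
      (z - s k ∈ (u k).1.pts i ↔ z - s n ∈ (u n).1.pts i) := by
    intro n i z hz k hk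
    induction k, hk using Nat.le_induction with
    | base => rfl
    | succ k hk ih =>
      rw [← ih, hvu k i (z - s k), hs_succ k, show v k + (z - (v k + s (k + 1))) = z - s (k + 1) by
        abel]
      have h1 := norm_sub_le z (s k)
      have h2 := hs_norm k
      have h3 : (2 : ℝ) ^ n ≤ 2 ^ k := pow_le_pow_right₀ (by norm_num) hk
      linarith
  have hpow : ∀ R : ℝ, ∀ᶠ n : ℕ in atTop, R ≤ 2 ^ n := fun R =>
    (tendsto_pow_atTop_atTop_of_one_lt (by norm_num)).eventually_ge_atTop R
  set G : Fin m → Set (E d) := fun i => {z | ∀ᶠ n in atTop, z - s n ∈ (u n).1.pts i} with hG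
  have hGmem : ∀ n i (z : E d), ‖z‖ + 2 ≤ 2 ^ n → (z ∈ G i ↔ z - s n ∈ (u n).1.pts i) := by
    intro n i z hz
    constructor
    · intro h
      obtain ⟨k, hk1, hk2⟩ := (h.and (eventually_ge_atTop n)).exists
      exact (hstab n i z hz k hk2).mp hk1
    · intro h
      filter_upwards [eventually_ge_atTop n] with k hk
      exact (hstab n i z hz k hk).mpr h
  have hGL : LocallyLike Λ G := by
    intro R
    obtain ⟨n, hn⟩ := (hpow (R + 2)).exists
    obtain ⟨h, hh⟩ := mem_hull_iff.mp (u n).2 (R + 2)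
    refine ⟨h - s n, fun i z hz => ?_⟩
    rw [hGmem n i z (by linarith), hh i _ ((norm_sub_le _ _).trans (add_le_add hz (hs_norm n))),
      show h + (z - s n) = h - s n + z by abel]
  obtain ⟨Γ, hΓ, hΓG⟩ := hGL.exists_mem_hull
  refine ⟨⟨Γ, hΓ⟩, ?_⟩
  rw [Metric.tendsto_atTop']
  intro δ hδ
  obtain ⟨ε, hε, hεδ, -, -⟩ := exists_radius 0 (half_pos hδ)
  have hev : ∀ᶠ n in atTop, dist (u n) ⟨Γ, hΓ⟩ < δ := by
    filter_upwards [hpow (1 / ε + 4), Metric.tendsto_nhds.mp hs_lim ε hε] with n hn hsn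
    have hnear : DeloneMultiset.Near ε (u n).1 Γ := by
      refine near_of_forall hε (s n) (by simpa using hsn.le) fun i z hz => ?_
      rw [hΓG, hGmem n i _ ?_, add_sub_cancel_left]
      have := norm_add_le (s n) z
      have := hs_norm n
      linarith
    have := hnear.distFun_le hε
    change dist (u n).1 Γ < δ
    linarith
  obtain ⟨N, hN⟩ := eventually_atTop.mp hev
  exact ⟨N, fun n hn => hN n (le_of_lt hn)⟩

lemma compactSpace_hull {Λ : DeloneMultiset d m} (hΛ : HasFLC Λ) : CompactSpace (hull Λ) := by
  have := completeSpace_hull Λ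
  rw [← isCompact_iff_compactSpace, isCompact_iff_totallyBounded_isComplete]
  exact ⟨(totallyBounded_orbit hΛ).closure.subset Set.inter_subset_right,
    (completeSpace_coe_iff_isComplete).mp this⟩

/-! ### Cylinder sets -/

@[simp] lemma hull_vadd_coe {Λ : DeloneMultiset d m} (t : E d) (Γ : hull Λ) :
    (t +ᵥ Γ).1 = t +ᵥ Γ.1 := rfl

instance (Λ : DeloneMultiset d m) : ContinuousVAdd (E d) (hull Λ) where
  continuous_vadd := by
    rw [continuous_iff_continuousAt]
    rintro ⟨t, Γ⟩
    rw [ContinuousAt, tendsto_iff_dist_tendsto_zero]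
    have h1 : Tendsto (fun p : E d × hull Λ => dist p.1 t + dist (t +ᵥ p.2.1) (t +ᵥ Γ.1))
        (𝓝 (t, Γ)) (𝓝 (dist t t + dist (t +ᵥ Γ.1) (t +ᵥ Γ.1))) := by
      refine Continuous.tendsto (f := fun p : E d × hull Λ =>
        dist p.1 t + dist (t +ᵥ p.2.1) (t +ᵥ Γ.1)) ?_ (t, Γ)
      have h2 : Continuous fun p : E d × hull Λ => t +ᵥ p.2.1 :=
        (continuous_const_vadd t).comp (continuous_subtype_val.comp continuous_snd)
      fun_prop
    rw [dist_self, dist_self, add_zero] at h1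
    refine squeeze_zero (fun _ => dist_nonneg) (fun p => ?_) h1
    exact (dist_triangle _ (t +ᵥ p.2.1) _).trans
      (add_le_add (dist_vadd_vadd_le p.1 t p.2.1) le_rfl)

lemma eq_of_dist_lt {Λ : DeloneMultiset d m} {η : ℝ}
    (hη : ∀ z : E d, (Λ.supp ∩ Metric.closedBall z (η / 2)).Subsingleton)
    {Γ : DeloneMultiset d m} (hΓ : Γ ∈ hull Λ) {i : Fin m} {x y : E d}
    (hx : x ∈ Γ.pts i) (hy : y ∈ Γ.pts i) (hxy : dist x y < η) : x = y := by
  obtain ⟨h, hh⟩ := mem_hull_iff.mp hΓ (max ‖x‖ ‖y‖)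
  have hx' := Set.mem_iUnion_of_mem i ((hh i x (le_max_left _ _)).mp hx)
  have hy' := Set.mem_iUnion_of_mem i ((hh i y (le_max_right _ _)).mp hy)
  have hd : dist (h + x) (h + y) < η := by simpa using hxy
  refine add_left_cancel (hη (midpoint ℝ (h + x) (h + y)) ⟨hx', ?_⟩ ⟨hy', ?_⟩)
  · rw [Metric.mem_closedBall, dist_left_midpoint, Real.norm_ofNat]
    linarith
  · rw [Metric.mem_closedBall, dist_right_midpoint, Real.norm_ofNat]
    linarith

/-- Some `η > 0` with the separation property required of `η(Λ)` exists. -/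
lemma exists_separation (Λ : DeloneMultiset d m) :
    ∃ η : ℝ, 0 < η ∧ ∀ z : E d, (Λ.supp ∩ Metric.closedBall z (η / 2)).Subsingleton := by
  obtain ⟨D, hD⟩ := Λ.isDelone_supp
  refine ⟨D.packingRadius, D.packingRadius_pos, fun z x hx y hy => ?_⟩
  by_contra hne
  have h1 : x ∈ D := by
    have := hx.1
    rwa [DeloneMultiset.supp, ← hD] at this
  have h2 : y ∈ D := by
    have := hy.1
    rwa [DeloneMultiset.supp, ← hD] at this
  have h3 := D.packingRadius_lt_dist_of_mem_ne h1 h2 hne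
  have h4 := dist_triangle_right x y z
  have h5 := Metric.mem_closedBall.mp hx.2
  have h6 := Metric.mem_closedBall.mp hy.2
  linarith

lemma dist_lt_of_ediam_lt {V : Set (E d)} {η : ℝ} (hV : Metric.ediam V < ENNReal.ofReal η)
    {g g' : E d} (hg : g ∈ V) (hg' : g' ∈ V) : dist g g' < η := by
  have h := (Metric.edist_le_ediam_of_mem hg hg').trans_lt hV
  rw [edist_dist] at h
  exact (ENNReal.ofReal_lt_ofReal_iff_of_nonneg dist_nonneg).mp h

lemma isBounded_of_ediam_lt {V : Set (E d)} {η : ℝ} (hV : Metric.ediam V < ENNReal.ofReal η) :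
    Bornology.IsBounded V :=
  Metric.isBounded_iff_ediam_ne_top.mpr (hV.trans ENNReal.ofReal_lt_top).ne

lemma mem_cylinder {Λ : DeloneMultiset d m} {P : Fin m → Set (E d)} {V : Set (E d)}
    {Γ : hull Λ} : Γ ∈ cylinder Λ P V ↔ ∃ g ∈ V, ∀ i, ∀ p ∈ P i, p - g ∈ Γ.1.pts i := by
  simp only [cylinder, Set.mem_ofPred_eq, Set.vadd_set_subset_iff, vadd_eq_add, neg_add_eq_sub]

/-- The vector realising the membership in a cylinder over a small set is unique. -/
lemma cylinder_vector_unique {Λ : DeloneMultiset d m} {η : ℝ}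
    (hη : ∀ z : E d, (Λ.supp ∩ Metric.closedBall z (η / 2)).Subsingleton)
    {P : Fin m → Set (E d)} (hne : ∃ i, (P i).Nonempty)
    {Γ : DeloneMultiset d m} (hΓ : Γ ∈ hull Λ) {g g' : E d} (hgg : dist g g' < η)
    (hg : ∀ i, ∀ p ∈ P i, p - g ∈ Γ.pts i) (hg' : ∀ i, ∀ p ∈ P i, p - g' ∈ Γ.pts i) :
    g = g' := by
  obtain ⟨i, p, hp⟩ := hne
  exact sub_right_injective
    (eq_of_dist_lt hη hΓ (hg i p hp) (hg' i p hp) (by rwa [dist_sub_left]))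

lemma isClosed_setOf_mem_pts (p : E d) (i : Fin m) :
    IsClosed {Γ : DeloneMultiset d m | p ∈ Γ.pts i} := by
  refine isClosed_of_closure_subset fun Γ hΓ => ?_
  change p ∈ Γ.pts i
  rw [← (Γ.isDelone_pts i).isClosed.closure_eq, Metric.mem_closure_iff]
  intro δ hδ
  obtain ⟨ε, hε, hεδ, hε2, hR⟩ := exists_radius ‖p‖ (show 0 < δ / 3 by linarith)
  obtain ⟨Γ', hΓ', hlt⟩ := Metric.mem_closure_iff.mp hΓ ε hε
  obtain ⟨x, y, hx, hy, hxy⟩ :=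
    DeloneMultiset.near_iff.mp (DeloneMultiset.near_of_distFun_lt hlt hε2)
  have h1 := (hxy i (p - y) ((norm_sub_le _ _).trans (by linarith))).mpr
    (by rw [add_sub_cancel]; exact hΓ')
  refine ⟨_, h1, ?_⟩
  rw [dist_eq_norm, show p - (x + (p - y)) = y - x by abel]
  have := norm_sub_le y x
  linarith

/-- The cylinder is the projection of a closed subset of the compact space `V × hull Λ`. -/
lemma isClosed_cylinder {Λ : DeloneMultiset d m} [CompactSpace (hull Λ)]
    (P : Fin m → Set (E d)) {V : Set (E d)} (hV : IsCompact V) :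
    IsClosed (cylinder Λ P V) := by
  have hc : IsClosed {q : E d × hull Λ | ∀ i, ∀ p ∈ P i, p ∈ (q.1 +ᵥ q.2).1.pts i} := by
    simp only [Set.ofPred_forall]
    refine isClosed_iInter fun i => isClosed_iInter fun p => isClosed_iInter fun _ => ?_
    exact (isClosed_setOf_mem_pts p i).preimage
      (continuous_subtype_val.comp (continuous_vadd (M := E d) (X := hull Λ)))
  have hK : IsCompact ((V ×ˢ (Set.univ : Set (hull Λ))) ∩
      {q : E d × hull Λ | ∀ i, ∀ p ∈ P i, p ∈ (q.1 +ᵥ q.2).1.pts i}) :=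
    (hV.prod isCompact_univ).inter_right hc
  convert (hK.image continuous_snd).isClosed using 1
  ext Γ
  simp only [mem_cylinder, Set.mem_image, Set.mem_inter_iff, Set.mem_prod, Set.mem_univ, and_true,
    Set.mem_ofPred_eq, hull_vadd_coe, mem_vadd_pts, Prod.exists, exists_eq_right]

/-- For compact `V` the cylinder is closed; inside a fixed small set, `V ↦ cylinder Λ P V`
commutes with countable unions and, by uniqueness of the realising vector, with complements. -/
lemma measurableSet_cylinder {Λ : DeloneMultiset d m} [CompactSpace (hull Λ)] {η : ℝ}
    (hη : ∀ z : E d, (Λ.supp ∩ Metric.closedBall z (η / 2)).Subsingleton)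
    {P : Fin m → Set (E d)} (hne : ∃ i, (P i).Nonempty) {V : Set (E d)} (hV : MeasurableSet V)
    (hVη : Metric.ediam V < ENNReal.ofReal η) : MeasurableSet (cylinder Λ P V) := by
  set W := closure V with hW
  have hWη : Metric.ediam W < ENNReal.ofReal η := by rwa [hW, Metric.ediam_closure]
  have hWc : IsCompact W :=
    Metric.isCompact_of_isClosed_isBounded isClosed_closure (isBounded_of_ediam_lt hWη)
  suffices h : ∀ U : Set (E d), MeasurableSet U → MeasurableSet (cylinder Λ P (U ∩ W)) by
    have := h V hV
    rwa [Set.inter_eq_left.mpr subset_closure] at this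
  intro U hU
  rw [BorelSpace.measurable_eq (α := E d), borel_eq_generateFrom_isClosed] at hU
  induction U, hU using MeasurableSpace.generateFrom_induction with
  | hC U hU _ => exact (isClosed_cylinder P (hWc.inter_left hU)).measurableSet
  | empty => simp [cylinder]
  | compl U _ ih =>
    have : cylinder Λ P (Uᶜ ∩ W) = cylinder Λ P W \ cylinder Λ P (U ∩ W) := by
      ext Γ
      simp only [Set.mem_sdiff, mem_cylinder]
      constructor
      · rintro ⟨g, hg, h⟩
        refine ⟨⟨g, hg.2, h⟩, ?_⟩
        rintro ⟨g', hg', h'⟩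
        have := cylinder_vector_unique hη hne Γ.2 (dist_lt_of_ediam_lt hWη hg.2 hg'.2) h h'
        exact hg.1 (this ▸ hg'.1)
      · rintro ⟨⟨g, hg, h⟩, hn⟩
        exact ⟨g, ⟨fun hgU => hn ⟨g, ⟨hgU, hg⟩, h⟩, hg⟩, h⟩
    rw [this]
    exact (isClosed_cylinder P hWc).measurableSet.diff ih
  | iUnion U _ ih =>
    have : cylinder Λ P ((⋃ n, U n) ∩ W) = ⋃ n, cylinder Λ P (U n ∩ W) := by
      ext Γ
      simp only [mem_cylinder, Set.mem_iUnion, Set.mem_inter_iff]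
      constructor
      · rintro ⟨g, ⟨⟨n, hn⟩, hg⟩, h⟩
        exact ⟨n, g, ⟨hn, hg⟩, h⟩
      · rintro ⟨n, g, ⟨hn, hg⟩, h⟩
        exact ⟨g, ⟨⟨n, hn⟩, hg⟩, h⟩
    rw [this]
    exact MeasurableSet.iUnion ih

/-! ### Frequencies and the measure of cylinders -/

/-- A closed ball is connected, so it meets the frontier of `F` as soon as it meets both `F` and
its complement. -/
lemma mem_cthickening_frontier {F : Set (E d)} {a b t : E d} {r : ℝ} (ha : a ∈ F) (hb : b ∉ F)
    (hta : dist t a ≤ r) (htb : dist t b ≤ r) : t ∈ Metric.cthickening r (frontier F) := by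
  have hconv : Convex ℝ (Metric.closedBall t r) := convex_closedBall t r
  by_contra hcon
  have hdisj : ∀ z ∈ Metric.closedBall t r, z ∉ frontier F := fun z hz hzF =>
    hcon (Metric.mem_cthickening_of_dist_le t z r _ hzF (by rwa [dist_comm]))
  have hsub : Metric.closedBall t r ⊆ interior F ∪ interior Fᶜ := by
    intro z hz
    rw [← compl_frontier_eq_union_interior]
    exact hdisj z hz
  have h1 := hconv.isPreconnected.subset_left_of_subset_union isOpen_interior isOpen_interior
    (disjoint_compl_right.mono interior_subset interior_subset) hsub ?_
  · exact hb (interior_subset (h1 (by rwa [Metric.mem_closedBall, dist_comm])))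
  · have ha' : a ∈ Metric.closedBall t r := by rwa [Metric.mem_closedBall, dist_comm]
    refine ⟨a, ha', (hsub ha').resolve_right fun h => interior_subset h ha⟩

/-- The vectors which translate `P` into `Γ`. -/
def occurrences (Γ : DeloneMultiset d m) (P : Fin m → Set (E d)) : Set (E d) :=
  {x | ∀ i, ∀ p ∈ P i, x + p ∈ Γ.pts i}

lemma clusterCount_eq (Γ : DeloneMultiset d m) (P : Fin m → Set (E d)) (A : Set (E d)) :
    clusterCount Γ P A = {x | x ∈ occurrences Γ P ∧ ∀ i, ∀ p ∈ P i, x + p ∈ A}.ncard := by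
  rw [clusterCount]
  congr 1
  ext x
  simp only [occurrences, Set.mem_ofPred_eq, Set.vadd_set_subset_iff, Set.mem_inter_iff,
    vadd_eq_add]
  exact ⟨fun h => ⟨fun i p hp => (h i hp).2, fun i p hp => (h i hp).1⟩,
    fun h i p hp => ⟨h.2 i p hp, h.1 i p hp⟩⟩

lemma finite_inter_of_isDelone {S A : Set (E d)} (hS : IsDelone S) (hA : Bornology.IsBounded A) :
    (A ∩ S).Finite := by
  refine Metric.finite_isBounded_inter_isClosed ?_ hA hS.isClosed
  obtain ⟨D, rfl⟩ := hS
  refine ⟨DiscreteTopology.of_forall_le_dist (r := D.packingRadius) D.packingRadius_pos ?_⟩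
  intro x y hne
  exact (D.packingRadius_lt_dist_of_mem_ne x.2 y.2 (by simpa [Subtype.ext_iff] using hne)).le

lemma countable_of_isDelone {S : Set (E d)} (hS : IsDelone S) : S.Countable := by
  have : S = ⋃ n : ℕ, Metric.closedBall 0 n ∩ S := by
    rw [← Set.iUnion_inter, Metric.iUnion_closedBall_nat, Set.univ_inter]
  rw [this]
  exact Set.countable_iUnion fun n =>
    (finite_inter_of_isDelone hS Metric.isBounded_closedBall).countable

lemma finite_occurrences (Γ : DeloneMultiset d m) {P : Fin m → Set (E d)}
    (hne : ∃ i, (P i).Nonempty) {A : Set (E d)} (hA : Bornology.IsBounded A) :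
    {x | x ∈ occurrences Γ P ∧ ∀ i, ∀ p ∈ P i, x + p ∈ A}.Finite := by
  obtain ⟨i, p, hp⟩ := hne
  exact ((finite_inter_of_isDelone (Γ.isDelone_pts i) hA).preimage
    (f := fun x => x + p) (add_left_injective p).injOn).subset
      fun x hx => ⟨hx.2 i p hp, hx.1 i p hp⟩

/-- The occurrences of `P` in `Γ` inside `F` account for the set of translations bringing `Γ`
into a cylinder, up to translations near the frontier of `F`: both sides count the translates
`x + V` by occurrences `x`, and away from the frontier `x + P` and `x + V` lie in `F` together. -/
lemma abs_volume_sub_clusterCount_le {Γ : DeloneMultiset d m} {P : Fin m → Set (E d)}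
    (hne : ∃ i, (P i).Nonempty) {V F : Set (E d)} (hV : MeasurableSet V)
    (hFb : Bornology.IsBounded F)
    (hdisj : (occurrences Γ P).PairwiseDisjoint fun x => x +ᵥ V)
    {r : ℝ} (hPr : ∀ i, ∀ p ∈ P i, ‖p‖ ≤ r) (hVr : ∀ g ∈ V, ‖g‖ ≤ r) :
    |volume.real (F ∩ ⋃ x ∈ occurrences Γ P, (x +ᵥ V)) - clusterCount Γ P F * volume.real V| ≤
      volume.real (Metric.cthickening (2 * r) (frontier F)) := by
  set U := ⋃ x ∈ occurrences Γ P, (x +ᵥ V) with hU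
  set T := Metric.cthickening (2 * r) (frontier F) with hT
  have hS := finite_occurrences Γ hne hFb
  rw [clusterCount_eq]
  set S := {x | x ∈ occurrences Γ P ∧ ∀ i, ∀ p ∈ P i, x + p ∈ F} with hSdef
  set W := ⋃ x ∈ S, (x +ᵥ V) with hW
  have hVb : Bornology.IsBounded V := isBounded_iff_forall_norm_le.mpr ⟨r, hVr⟩
  have hTfin : volume T ≠ ⊤ := by
    refine (Bornology.IsBounded.measure_lt_top ?_).ne
    exact (Bornology.IsBounded.subset hFb.closure frontier_subset_closure).cthickening
  have hFfin : volume F ≠ ⊤ := hFb.measure_lt_top.ne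
  have hWvol : volume W = S.ncard * volume V := by
    rw [hW, measure_biUnion hS.countable (hdisj.subset fun x hx => hx.1)
      fun x _ => hV.const_vadd x]
    simp only [measure_vadd]
    rw [ENNReal.tsum_set_const, ← hS.cast_ncard_eq]
    rfl
  have hWreal : volume.real W = S.ncard * volume.real V := by
    simp [measureReal_def, hWvol]
  have hWfin : volume W ≠ ⊤ := by
    rw [hWvol]; exact ENNReal.mul_ne_top (by simp) hVb.measure_lt_top.ne
  have h1 : F ∩ U ⊆ W ∪ T := by
    rintro t ⟨htF, htU⟩
    obtain ⟨x, hx, g, hg, rfl⟩ := Set.mem_iUnion₂.mp htU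
    by_cases hxS : x ∈ S
    · exact Or.inl (Set.mem_biUnion hxS ⟨g, hg, rfl⟩)
    · right
      have : ∃ i, ∃ p ∈ P i, x + p ∉ F := by
        by_contra! hcon
        exact hxS ⟨hx, hcon⟩
      obtain ⟨i, p, hp, hpF⟩ := this
      have h2 := norm_sub_le g p
      have h3 := hPr i p hp
      have h4 := hVr g hg
      refine mem_cthickening_frontier htF hpF ?_ ?_
      · rw [dist_self]; linarith [norm_nonneg g]
      · change dist (x + g) (x + p) ≤ _
        rw [dist_add_left, dist_eq_norm]; linarith
  have h2 : W ⊆ (F ∩ U) ∪ T := by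
    intro t ht
    obtain ⟨x, hx, g, hg, rfl⟩ := Set.mem_iUnion₂.mp ht
    by_cases htF : x +ᵥ g ∈ F
    · exact Or.inl ⟨htF, Set.mem_biUnion hx.1 ⟨g, hg, rfl⟩⟩
    · right
      obtain ⟨i, p, hp⟩ := hne
      have h2 := norm_sub_le g p
      have h3 := hPr i p hp
      have h4 := hVr g hg
      refine mem_cthickening_frontier (hx.2 i p hp) htF ?_ ?_
      · change dist (x + g) (x + p) ≤ _
        rw [dist_add_left, dist_eq_norm]; linarith
      · change dist (x +ᵥ g) (x +ᵥ g) ≤ _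
        rw [dist_self]; linarith [norm_nonneg g]
  have hFU : volume (F ∩ U) ≠ ⊤ := measure_ne_top_of_subset Set.inter_subset_left hFfin
  have h3 := (measureReal_mono h1 (measure_union_ne_top hWfin hTfin)).trans
    (measureReal_union_le (μ := volume) W T)
  have h4 := (measureReal_mono h2 (measure_union_ne_top hFU hTfin)).trans
    (measureReal_union_le (μ := volume) (F ∩ U) T)
  rw [← hWreal, abs_sub_le_iff]
  constructor <;> linarith

/-- Counting in an element of the hull is counting in `Λ` inside a translated window. -/
lemma exists_clusterCount_eq {Λ Γ : DeloneMultiset d m} (hΓ : Γ ∈ hull Λ)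
    (P : Fin m → Set (E d)) {A : Set (E d)} (hA : Bornology.IsBounded A) :
    ∃ h : E d, clusterCount Γ P A = clusterCount Λ P (h +ᵥ A) := by
  obtain ⟨R, hR⟩ := hA.exists_norm_le
  obtain ⟨h, hh⟩ := mem_hull_iff.mp hΓ R
  refine ⟨h, ?_⟩
  have hinj : Function.Injective fun x : E d => h + x := add_right_injective h
  rw [clusterCount, clusterCount, ← Set.ncard_image_of_injective _ hinj]
  congr 1
  ext y
  simp only [Set.mem_image, Set.mem_ofPred_eq, Set.vadd_set_subset_iff, Set.mem_inter_iff,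
    Set.mem_vadd_set_iff_neg_vadd_mem, vadd_eq_add]
  constructor
  · rintro ⟨x, hx, rfl⟩ i p hp
    have := hx i hp
    refine ⟨by simpa [add_assoc] using this.1, ?_⟩
    rw [add_assoc]
    exact (hh i _ (hR _ this.1)).mp this.2
  · intro hy
    refine ⟨-h + y, fun i p hp => ?_, by simp⟩
    obtain ⟨h1, h2⟩ := hy i hp
    rw [← add_assoc] at h1
    refine ⟨h1, (hh i _ (hR _ h1)).mpr ?_⟩
    simpa [add_assoc] using h2

/-- The uniform frequency of `P` computes, at every point of the hull, the density of the
translations which lead into a cylinder. -/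
lemma tendsto_average_cylinder {Λ : DeloneMultiset d m} {F : ℕ → Set (E d)} (hF : IsVanHove F)
    (hUCF : HasUCF F Λ) {η : ℝ}
    (hη : ∀ z : E d, (Λ.supp ∩ Metric.closedBall z (η / 2)).Subsingleton)
    {P : Fin m → Set (E d)} (hP : IsCluster P Λ) (hne : ∃ i, (P i).Nonempty) {V : Set (E d)}
    (hV : MeasurableSet V) (hVη : Metric.ediam V < ENNReal.ofReal η) (Γ : hull Λ) :
    Tendsto (fun n => volume.real (F n ∩ {t | -t +ᵥ Γ ∈ cylinder Λ P V}) / volume.real (F n))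
      atTop (𝓝 (volume.real V * freq F Λ P)) := by
  have hU : {t : E d | -t +ᵥ Γ ∈ cylinder Λ P V} = ⋃ x ∈ occurrences Γ.1 P, (x +ᵥ V) := by
    ext t
    simp only [Set.mem_ofPred_eq, mem_cylinder, hull_vadd_coe, mem_vadd_pts, Set.mem_iUnion,
      occurrences, exists_prop, Set.mem_vadd_set_iff_neg_vadd_mem, vadd_eq_add]
    constructor
    · rintro ⟨g, hg, h⟩
      refine ⟨t - g, fun i p hp => ?_, by simpa using hg⟩
      convert h i p hp using 1; abel
    · rintro ⟨x, hx, hg⟩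
      refine ⟨-x + t, hg, fun i p hp => ?_⟩
      convert hx i p hp using 1; abel
  have hdisj : (occurrences Γ.1 P).PairwiseDisjoint fun x => x +ᵥ V := by
    intro x hx x' hx' hxx
    rw [Function.onFun, Set.disjoint_left]
    rintro _ ⟨g, hg, rfl⟩ ⟨g', hg', h⟩
    obtain ⟨i, p, hp⟩ := hne
    have h' : x' + g' = x + g := h
    refine hxx (add_right_cancel (eq_of_dist_lt hη Γ.2 (hx i p hp) (hx' i p hp) ?_))
    have : dist (x + p) (x' + p) = dist g' g := by
      rw [dist_add_right, dist_eq_norm, dist_eq_norm]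
      congr 1
      rw [sub_eq_sub_iff_add_eq_add, ← h', add_comm]
    rw [this]
    exact dist_lt_of_ediam_lt hVη hg' hg
  obtain ⟨r, hr⟩ := ((Set.finite_iUnion fun i => (hP i).1).isBounded.union
    (isBounded_of_ediam_lt hVη)).exists_norm_le
  have hPr : ∀ i, ∀ p ∈ P i, ‖p‖ ≤ max r 1 := fun i p hp =>
    (hr p (Or.inl (Set.mem_iUnion_of_mem i hp))).trans (le_max_left _ _)
  have hVr : ∀ g ∈ V, ‖g‖ ≤ max r 1 := fun g hg => (hr g (Or.inr hg)).trans (le_max_left _ _)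
  have hpos : ∀ n, 0 < volume.real (F n) := fun n =>
    ENNReal.toReal_pos (hF.volume_pos n).ne' (hF.isBounded n).measure_lt_top.ne
  have herr : Tendsto (fun n => volume.real (Metric.cthickening (2 * max r 1) (frontier (F n))) /
      volume.real (F n)) atTop (𝓝 0) := by
    have := (ENNReal.tendsto_toReal ENNReal.zero_ne_top).comp
      (hF.tendsto (2 * max r 1) (by positivity))
    simpa [Function.comp_def, ENNReal.toReal_div, measureReal_def] using this
  have hcount : Tendsto (fun n => (clusterCount Γ.1 P (F n) : ℝ) / volume.real (F n)) atTop
      (𝓝 (freq F Λ P)) := by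
    rw [Metric.tendsto_nhds]
    intro ε hε
    filter_upwards [Metric.tendstoUniformly_iff.mp (hUCF P hP hne) ε hε] with n hn
    obtain ⟨h, hh⟩ := exists_clusterCount_eq Γ.2 P (hF.isBounded n)
    rw [hh, dist_comm]
    exact hn h
  have hmain := hcount.const_mul (volume.real V)
  refine tendsto_of_tendsto_of_dist hmain (squeeze_zero (fun _ => dist_nonneg) (fun n => ?_) herr)
  rw [dist_comm, Real.dist_eq, hU, mul_div_assoc', ← sub_div, abs_div, abs_of_pos (hpos n),
    mul_comm (volume.real V)]
  exact div_le_div_of_nonneg_right (abs_volume_sub_clusterCount_le hne hV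
    (hF.isBounded n) hdisj hPr hVr) (hpos n).le

/-- Averaging over translations does not change the measure of a set under an invariant
measure; for a cylinder the averages converge to the frequency. -/
lemma measure_cylinder {Λ : DeloneMultiset d m} [CompactSpace (hull Λ)] {F : ℕ → Set (E d)}
    (hF : IsVanHove F) (hUCF : HasUCF F Λ) {μ : Measure (hull Λ)} (hμ : IsInvariantProb Λ μ)
    {η : ℝ} (hη : ∀ z : E d, (Λ.supp ∩ Metric.closedBall z (η / 2)).Subsingleton)
    {P : Fin m → Set (E d)} (hP : IsCluster P Λ) (hne : ∃ i, (P i).Nonempty) {V : Set (E d)}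
    (hV : MeasurableSet V) (hVη : Metric.ediam V < ENNReal.ofReal η) :
    μ (cylinder Λ P V) = ENNReal.ofReal (volume.real V * freq F Λ P) := by
  have := hμ.1
  have := hμ.2
  have hA := measurableSet_cylinder hη hne hV hVη
  set A := cylinder Λ P V with hAdef
  have hFfin : ∀ n, volume (F n) ≠ ⊤ := fun n => (hF.isBounded n).measure_lt_top.ne
  have hpos : ∀ n, 0 < volume.real (F n) := fun n =>
    ENNReal.toReal_pos (hF.volume_pos n).ne' (hFfin n)
  have hpre : MeasurableSet {q : hull Λ × E d | -q.2 +ᵥ q.1 ∈ A} := by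
    have hc : Continuous fun q : hull Λ × E d => -q.2 +ᵥ q.1 := by fun_prop
    exact hc.measurable hA
  have hslice : ∀ n (Γ : hull Λ), (volume.restrict (F n)) (Prod.mk Γ ⁻¹' {q | -q.2 +ᵥ q.1 ∈ A}) =
      volume (F n ∩ {t | -t +ᵥ Γ ∈ A}) := by
    intro n Γ
    rw [Measure.restrict_apply (measurable_prodMk_left hpre), Set.inter_comm]
    rfl
  have hint : ∀ n, ∫⁻ Γ, volume (F n ∩ {t | -t +ᵥ Γ ∈ A}) / volume (F n) ∂μ = μ A := by
    intro n
    have : IsFiniteMeasure (volume.restrict (F n)) := ⟨by simpa using (hF.isBounded n).measure_lt_top⟩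
    have h1 := Measure.prod_apply (μ := μ) (ν := volume.restrict (F n)) hpre
    rw [Measure.prod_apply_symm hpre] at h1
    simp only [hslice] at h1
    have h2 : ∀ t : E d, μ ((fun Γ => (Γ, t)) ⁻¹' {q | -q.2 +ᵥ q.1 ∈ A}) = μ A := fun t =>
      measure_preimage_vadd μ (-t) A
    simp only [h2, lintegral_const, Measure.restrict_apply_univ] at h1
    simp only [div_eq_mul_inv]
    rw [lintegral_mul_const' _ _ (ENNReal.inv_ne_top.mpr (hF.volume_pos n).ne'), ← h1, mul_assoc,
      ENNReal.mul_inv_cancel (hF.volume_pos n).ne' (hFfin n), mul_one]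
  have hlim : Tendsto (fun n => ∫⁻ Γ, volume (F n ∩ {t | -t +ᵥ Γ ∈ A}) / volume (F n) ∂μ) atTop
      (𝓝 (∫⁻ _, ENNReal.ofReal (volume.real V * freq F Λ P) ∂μ)) := by
    refine tendsto_lintegral_of_dominated_convergence (fun _ => 1) (fun n => ?_) (fun n => ?_)
      (by simp) ?_
    · have : IsFiniteMeasure (volume.restrict (F n)) :=
        ⟨by simpa using (hF.isBounded n).measure_lt_top⟩
      have h := measurable_measure_prodMk_left (ν := volume.restrict (F n)) hpre
      simp only [hslice] at h
      exact h.div_const _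
    · exact Eventually.of_forall fun Γ =>
        ENNReal.div_le_of_le_mul (by rw [one_mul]; exact measure_mono Set.inter_subset_left)
    · refine Eventually.of_forall fun Γ => ?_
      have h := ENNReal.tendsto_ofReal (tendsto_average_cylinder hF hUCF hη hP hne hV hVη Γ)
      refine h.congr fun n => ?_
      rw [ENNReal.ofReal_div_of_pos (hpos n), ofReal_measureReal (hFfin n), ofReal_measureReal
        (measure_ne_top_of_subset Set.inter_subset_left (hFfin n))]
  simp only [hint, lintegral_const, measure_univ, mul_one] at hlim
  exact tendsto_nhds_unique tendsto_const_nhds hlim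

/-! ### Uniqueness of the invariant measure -/

lemma cylinder_vadd (Λ : DeloneMultiset d m) (P : Fin m → Set (E d)) (V : Set (E d)) (y : E d) :
    cylinder Λ (fun i => y +ᵥ P i) V = cylinder Λ P (-y +ᵥ V) := by
  ext Γ
  simp only [mem_cylinder, Set.mem_vadd_set_iff_neg_vadd_mem, vadd_eq_add, neg_neg]
  constructor
  · rintro ⟨g, hg, h⟩
    refine ⟨g - y, by simpa using hg, fun i p hp => ?_⟩
    convert h i (y + p) (by simpa using hp) using 1; abel
  · rintro ⟨g, hg, h⟩
    refine ⟨y + g, hg, fun i p hp => ?_⟩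
    convert h i _ hp using 1; abel

/-- Two invariant measures agree on all cylinders over small sets: the pattern is either absent
from the hull, or a translate of a cluster of `Λ`. -/
lemma measure_cylinder_congr {Λ : DeloneMultiset d m} [CompactSpace (hull Λ)]
    {F : ℕ → Set (E d)} (hF : IsVanHove F) (hUCF : HasUCF F Λ) {μ ν : Measure (hull Λ)}
    (hμ : IsInvariantProb Λ μ) (hν : IsInvariantProb Λ ν) {η : ℝ}
    (hη : ∀ z : E d, (Λ.supp ∩ Metric.closedBall z (η / 2)).Subsingleton)
    {P : Fin m → Set (E d)} (hfin : ∀ i, (P i).Finite) (hne : ∃ i, (P i).Nonempty)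
    {V : Set (E d)} (hV : MeasurableSet V) (hVη : Metric.ediam V < ENNReal.ofReal η) :
    μ (cylinder Λ P V) = ν (cylinder Λ P V) := by
  rcases (cylinder Λ P V).eq_empty_or_nonempty with h0 | ⟨Γ, g, hg, h⟩
  · simp [h0]
  obtain ⟨x, Q, hQ, hPQ⟩ := Γ.2.1 (fun i => -g +ᵥ P i) fun i => ⟨(hfin i).vadd_set, h i⟩
  have hP : P = fun i => (g + x) +ᵥ Q i := by
    ext1 i
    rw [add_vadd, ← hPQ i, vadd_neg_vadd]
  subst hP
  have hne' : ∃ i, (Q i).Nonempty := hne.imp fun i hi => by simpa using hi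
  have hV' : MeasurableSet (-(g + x) +ᵥ V) := hV.const_vadd _
  have hVη' : Metric.ediam (-(g + x) +ᵥ V) < ENNReal.ofReal η := by
    rwa [ediam_vadd]
  rw [cylinder_vadd, measure_cylinder hF hUCF hμ hη hQ hne' hV' hVη',
    measure_cylinder hF hUCF hν hη hQ hne' hV' hVη']

/-- Cylinders of arbitrary nonempty finite patterns over Borel sets of diameter less
than `η`. -/
def smallCylinders (Λ : DeloneMultiset d m) (η : ℝ) : Set (Set (hull Λ)) :=
  {A | ∃ (P : Fin m → Set (E d)) (V : Set (E d)), (∀ i, (P i).Finite) ∧ (∃ i, (P i).Nonempty) ∧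
    MeasurableSet V ∧ Metric.ediam V < ENNReal.ofReal η ∧ A = cylinder Λ P V}

/-- Countable disjoint unions of cylinders over small sets. -/
def cylinderUnions (Λ : DeloneMultiset d m) (η : ℝ) : Set (Set (hull Λ)) :=
  {A | ∃ (ι : Type) (_ : Countable ι) (f : ι → Set (hull Λ)),
    (∀ k, f k ∈ smallCylinders Λ η) ∧ Pairwise (Function.onFun Disjoint f) ∧ A = ⋃ k, f k}

lemma smallCylinders_subset (Λ : DeloneMultiset d m) (η : ℝ) :
    smallCylinders Λ η ⊆ cylinderUnions Λ η := fun A hA =>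
  ⟨Unit, inferInstance, fun _ => A, fun _ => hA, fun _ _ h => (h rfl).elim,
    (Set.iUnion_const A).symm⟩

/-- The intersection of two cylinders is decomposed according to the relative position of the
two patterns; only countably many positions occur, since both patterns have a point in a
translate of `Λ`. -/
lemma inter_mem_cylinderUnions {Λ : DeloneMultiset d m} {η : ℝ}
    (hη : ∀ z : E d, (Λ.supp ∩ Metric.closedBall z (η / 2)).Subsingleton)
    {A B : Set (hull Λ)} (hA : A ∈ smallCylinders Λ η) (hB : B ∈ smallCylinders Λ η) :
    A ∩ B ∈ cylinderUnions Λ η := by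
  obtain ⟨P, V, hPfin, hPne, hV, hVη, rfl⟩ := hA
  obtain ⟨Q, W, hQfin, hQne, hW, hWη, rfl⟩ := hB
  obtain ⟨i, p, hp⟩ := id hPne
  obtain ⟨j, q, hq⟩ := id hQne
  -- the possible values of `g - h`, when `-g + P` and `-h + Q` lie in one element of the hull
  set Δ : Set (E d) := Set.image2 (fun a b => p - q - (a - b)) (Λ.pts i) (Λ.pts j) with hΔ
  have hΔc : Δ.Countable := (countable_of_isDelone (Λ.isDelone_pts i)).image2
    (countable_of_isDelone (Λ.isDelone_pts j)) _
  have hmem : ∀ (δ : E d) (Γ : hull Λ),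
      Γ ∈ cylinder Λ (fun k => (-δ +ᵥ P k) ∪ Q k) (W ∩ (-δ +ᵥ V)) ↔
        ∃ h ∈ W, h + δ ∈ V ∧ (∀ k, ∀ x ∈ P k, x - (h + δ) ∈ Γ.1.pts k) ∧
          ∀ k, ∀ x ∈ Q k, x - h ∈ Γ.1.pts k := by
    intro δ Γ
    rw [mem_cylinder]
    refine exists_congr fun h => ?_
    simp only [Set.mem_inter_iff, Set.mem_vadd_set_iff_neg_vadd_mem, neg_neg, vadd_eq_add,
      Set.mem_union, and_assoc, add_comm δ]
    refine and_congr_right fun _ => and_congr_right fun _ => ?_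
    constructor
    · intro H
      refine ⟨fun k x hx => ?_, fun k x hx => H k x (Or.inr hx)⟩
      convert H k (x - δ) (Or.inl (by simpa using hx)) using 1; abel
    · rintro ⟨H1, H2⟩ k x (hx | hx)
      · convert H1 k _ hx using 1; abel
      · exact H2 k x hx
  refine ⟨Δ, hΔc.to_subtype, fun δ => cylinder Λ (fun k => (-δ.1 +ᵥ P k) ∪ Q k)
    (W ∩ (-δ.1 +ᵥ V)), fun δ => ?_, fun δ δ' hne => ?_, ?_⟩
  · exact ⟨_, _, fun k => (hPfin k).vadd_set.union (hQfin k), ⟨j, q, Or.inr hq⟩,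
      hW.inter (hV.const_vadd _), (Metric.ediam_mono Set.inter_subset_left).trans_lt hWη, rfl⟩
  · refine Set.disjoint_left.mpr fun Γ h1 h2 => hne ?_
    obtain ⟨h, hh, hhV, hP, hQ⟩ := (hmem _ _).mp h1
    obtain ⟨h', hh', hhV', hP', hQ'⟩ := (hmem _ _).mp h2
    obtain rfl := cylinder_vector_unique hη hQne Γ.2 (dist_lt_of_ediam_lt hWη hh hh') hQ hQ'
    exact Subtype.ext (add_left_cancel
      (cylinder_vector_unique hη hPne Γ.2 (dist_lt_of_ediam_lt hVη hhV hhV') hP hP'))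
  · ext Γ
    rw [Set.mem_iUnion]
    constructor
    · rintro ⟨hA, hB⟩
      obtain ⟨g, hg, hgP⟩ := mem_cylinder.mp hA
      obtain ⟨h, hh, hhQ⟩ := mem_cylinder.mp hB
      obtain ⟨t, ht⟩ := mem_hull_iff.mp Γ.2 (max ‖p - g‖ ‖q - h‖)
      refine ⟨⟨g - h, t + (p - g), (ht i _ (le_max_left _ _)).mp (hgP i p hp), t + (q - h),
        (ht j _ (le_max_right _ _)).mp (hhQ j q hq), ?_⟩, (hmem _ _).mpr ⟨h, hh, ?_, ?_, hhQ⟩⟩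
      · change p - q - (t + (p - g) - (t + (q - h))) = g - h
        abel
      · simpa using hg
      · simpa using hgP
    · rintro ⟨δ, hδ⟩
      obtain ⟨h, hh, hhV, hP, hQ⟩ := (hmem _ _).mp hδ
      exact ⟨mem_cylinder.mpr ⟨_, hhV, hP⟩, mem_cylinder.mpr ⟨h, hh, hQ⟩⟩

lemma isPiSystem_cylinderUnions {Λ : DeloneMultiset d m} {η : ℝ}
    (hη : ∀ z : E d, (Λ.supp ∩ Metric.closedBall z (η / 2)).Subsingleton) :
    IsPiSystem (cylinderUnions Λ η) := by
  rintro _ ⟨ι, hι, f, hf, hfd, rfl⟩ _ ⟨κ, hκ, g, hg, hgd, rfl⟩ -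
  choose O hO e he hed heq using fun k l => inter_mem_cylinderUnions hη (hf k) (hg l)
  refine ⟨Σ q : ι × κ, O q.1 q.2, inferInstance, fun s => e s.1.1 s.1.2 s.2,
    fun s => he _ _ _, ?_, ?_⟩
  · have hsub : ∀ k l o, e k l o ⊆ f k ∩ g l := fun k l o => by
      rw [heq k l]; exact Set.subset_iUnion _ o
    rintro ⟨⟨k, l⟩, o⟩ ⟨⟨k', l'⟩, o'⟩ hne
    by_cases hk : k = k'
    · by_cases hl : l = l'
      · subst hk hl
        exact hed k l fun h : o = o' => hne (by rw [h])
      · exact (hgd hl).mono ((hsub k l o).trans Set.inter_subset_right)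
          ((hsub k' l' o').trans Set.inter_subset_right)
    · exact (hfd hk).mono ((hsub k l o).trans Set.inter_subset_left)
        ((hsub k' l' o').trans Set.inter_subset_left)
  · rw [Set.iUnion_inter_iUnion, Set.iUnion_sigma, Set.iUnion_prod']
    exact Set.iUnion_congr fun k => Set.iUnion_congr fun l => heq k l

lemma measurableSet_of_mem_smallCylinders {Λ : DeloneMultiset d m} [CompactSpace (hull Λ)] {η : ℝ}
    (hη : ∀ z : E d, (Λ.supp ∩ Metric.closedBall z (η / 2)).Subsingleton)
    {A : Set (hull Λ)} (hA : A ∈ smallCylinders Λ η) : MeasurableSet A := by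
  obtain ⟨P, V, -, hPne, hV, hVη, rfl⟩ := hA
  exact measurableSet_cylinder hη hPne hV hVη

/-- Countably many one-point cylinders, over small balls with centres in a countable dense set,
separate the points of the hull. -/
lemma exists_countable_separating (Λ : DeloneMultiset d m) {η : ℝ} (hη0 : 0 < η) :
    ∃ S : Set (Set (hull Λ)), S.Countable ∧ S ⊆ smallCylinders Λ η ∧
      ∀ Γ Γ' : hull Λ, (∀ A ∈ S, Γ ∈ A ↔ Γ' ∈ A) → Γ = Γ' := by
  set P : Fin m → Fin m → Set (E d) := fun i j => {x | j = i ∧ x = 0} with hP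
  set r : ℕ → ℝ := fun n => min (1 / ((n : ℝ) + 1)) (η / 3) with hr
  have hr0 : ∀ n, 0 < r n := fun n => by positivity
  set C : Fin m × ℕ × ℕ → Set (hull Λ) := fun q =>
    cylinder Λ (P q.1) (Metric.ball (TopologicalSpace.denseSeq (E d) q.2.2) (r q.2.1)) with hC
  have hCmem : ∀ i n k (Γ : hull Λ), Γ ∈ C (i, n, k) ↔
      ∃ g, dist g (TopologicalSpace.denseSeq (E d) k) < r n ∧ -g ∈ Γ.1.pts i := by
    intro i n k Γ
    simp [hC, hP, mem_cylinder]
  refine ⟨Set.range C, Set.countable_range C, ?_, fun Γ Γ' h => ?_⟩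
  · rintro _ ⟨⟨i, n, k⟩, rfl⟩
    refine ⟨P i, Metric.ball _ (r n), fun j => (Set.finite_singleton (0 : E d)).subset
      fun x hx => hx.2, ⟨i, 0, rfl, rfl⟩, Metric.isOpen_ball.measurableSet, ?_, rfl⟩
    have h3 : r n ≤ η / 3 := min_le_right _ _
    refine (Metric.ediam_le (d := ENNReal.ofReal (η / 3 + η / 3)) fun x hx y hy => ?_).trans_lt
      ((ENNReal.ofReal_lt_ofReal_iff hη0).mpr (by linarith))
    rw [edist_dist]
    refine ENNReal.ofReal_le_ofReal ((dist_triangle_right x y _).trans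
      (add_le_add ((Metric.mem_ball.mp hx).le.trans h3) ((Metric.mem_ball.mp hy).le.trans h3)))
  · have key : ∀ Γ Γ' : hull Λ, (∀ A ∈ Set.range C, Γ ∈ A ↔ Γ' ∈ A) → ∀ i,
        Γ.1.pts i ⊆ Γ'.1.pts i := by
      intro Γ Γ' h i z hz
      rw [← (Γ'.1.isDelone_pts i).isClosed.closure_eq, Metric.mem_closure_iff]
      intro ε hε
      obtain ⟨n, hn⟩ := exists_nat_one_div_lt (half_pos hε)
      obtain ⟨k, hk⟩ := (TopologicalSpace.denseRange_denseSeq (E d)).exists_dist_lt (-z) (hr0 n)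
      have h1 : Γ ∈ C (i, n, k) := (hCmem i n k Γ).mpr ⟨-z, hk, by simpa using hz⟩
      obtain ⟨g, hg, hgΓ⟩ := (hCmem i n k Γ').mp ((h _ ⟨_, rfl⟩).mp h1)
      refine ⟨-g, hgΓ, ?_⟩
      have h2 : dist z (-g) = dist (-z) g := by rw [← dist_neg_neg, neg_neg]
      have h3 := dist_triangle_right (-z) g (TopologicalSpace.denseSeq (E d) k)
      have h4 : r n ≤ 1 / ((n : ℝ) + 1) := min_le_left _ _
      linarith
    refine Subtype.ext (DeloneMultiset.ext (funext fun i => ?_))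
    exact (key Γ Γ' h i).antisymm (key Γ' Γ (fun A hA => (h A hA).symm) i)

/-- By the Lusin-Souslin theorem, a sub-σ-algebra of a standard Borel σ-algebra which contains
countably many sets separating the points is the whole σ-algebra. -/
lemma borel_hull_eq_generateFrom {Λ : DeloneMultiset d m} [CompactSpace (hull Λ)] {η : ℝ}
    (hη0 : 0 < η) (hη : ∀ z : E d, (Λ.supp ∩ Metric.closedBall z (η / 2)).Subsingleton) :
    (inferInstance : MeasurableSpace (hull Λ)) =
      MeasurableSpace.generateFrom (cylinderUnions Λ η) := by
  have hle : MeasurableSpace.generateFrom (cylinderUnions Λ η) ≤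
      (inferInstance : MeasurableSpace (hull Λ)) := by
    refine MeasurableSpace.generateFrom_le ?_
    rintro _ ⟨ι, hι, f, hf, -, rfl⟩
    exact MeasurableSet.iUnion fun k => measurableSet_of_mem_smallCylinders hη (hf k)
  refine le_antisymm (fun s hs => ?_) hle
  obtain ⟨S, hSc, hS, hsep⟩ := exists_countable_separating Λ hη0
  have hcs : @MeasurableSpace.CountablySeparated (hull Λ)
      (MeasurableSpace.generateFrom (cylinderUnions Λ η)) := by
    refine @MeasurableSpace.CountablySeparated.mk _ (_) ⟨⟨S, hSc, fun A hA => ?_,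
      fun Γ _ Γ' _ h => hsep Γ Γ' h⟩⟩
    exact MeasurableSpace.measurableSet_generateFrom (smallCylinders_subset Λ η (hS hA))
  have h := @MeasurableSet.image_of_measurable_injOn (hull Λ) (hull Λ)
    (MeasurableSpace.generateFrom (cylinderUnions Λ η)) s id hcs inferInstance inferInstance hs
    (measurable_id'' hle) Function.injective_id.injOn
  rwa [Set.image_id] at h

lemma invariantProb_unique {Λ : DeloneMultiset d m} [CompactSpace (hull Λ)]
    {F : ℕ → Set (E d)} (hF : IsVanHove F) (hUCF : HasUCF F Λ) {μ ν : Measure (hull Λ)}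
    (hμ : IsInvariantProb Λ μ) (hν : IsInvariantProb Λ ν) : μ = ν := by
  obtain ⟨η, hη0, hη⟩ := exists_separation Λ
  have := hμ.1
  have := hν.1
  refine ext_of_generate_finite _ (borel_hull_eq_generateFrom hη0 hη)
    (isPiSystem_cylinderUnions hη) ?_ (by simp)
  rintro _ ⟨ι, hι, f, hf, hfd, rfl⟩
  have hm := fun k => measurableSet_of_mem_smallCylinders hη (hf k)
  rw [measure_iUnion hfd hm, measure_iUnion hfd hm]
  refine tsum_congr fun k => ?_
  obtain ⟨P, V, hPfin, hPne, hV, hVη, hfk⟩ := hf k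
  rw [hfk]
  exact measure_cylinder_congr hF hUCF hμ hν hη hPfin hPne hV hVη

/-! ### Existence of an invariant measure -/

/-- `Λ` as a point of its hull. -/
def hullBase (Λ : DeloneMultiset d m) : hull Λ :=
  ⟨Λ, mem_hull_iff.mpr fun _ => ⟨0, fun i z _ => by rw [zero_add]⟩⟩

/-- The averages of a bounded continuous function over a set and over a translate of it differ
by at most the contribution of a neighbourhood of the frontier. -/
lemma norm_setIntegral_sub_translate_le {f : E d → ℝ} (hf : Continuous f) {C : ℝ}
    (hC : ∀ t, ‖f t‖ ≤ C) {A : Set (E d)} (hA : NullMeasurableSet A)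
    (hAb : Bornology.IsBounded A) (s : E d) {r : ℝ} (hr : ‖s‖ ≤ r) :
    ‖(∫ t in A, f (t - s)) - ∫ t in A, f t‖ ≤
      C * volume.real (Metric.cthickening r (frontier A)) := by
  set T := Metric.cthickening r (frontier A) with hT
  have hTb : Bornology.IsBounded T :=
    (Bornology.IsBounded.subset hAb.closure frontier_subset_closure).cthickening
  have hint : ∀ g : E d → ℝ, Continuous g → (∀ t, ‖g t‖ ≤ C) → Integrable (A.indicator g) := by
    intro g hg hgC
    refine IntegrableOn.integrable_indicator₀ ?_ hA
    exact Measure.integrableOn_of_bounded hAb.measure_lt_top.ne hg.aestronglyMeasurable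
      (Eventually.of_forall hgC)
  have hi1 := (hint (fun t => f (t - s)) (by fun_prop) fun t => hC _).comp_add_right s
  have hi2 := hint f hf hC
  rw [← integral_indicator₀ hA, ← integral_indicator₀ hA,
    ← integral_add_right_eq_self (A.indicator fun t => f (t - s)) s, ← integral_sub hi1 hi2]
  have hTm : MeasurableSet T := Metric.isClosed_cthickening.measurableSet
  have hbound : ∫ t, T.indicator (fun _ => C) t = C * volume.real T := by
    rw [integral_indicator_const _ hTm, smul_eq_mul, mul_comm]
  rw [← hbound]
  refine norm_integral_le_of_norm_le ?_ (Eventually.of_forall fun t => ?_)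
  · rw [integrable_indicator_iff hTm]
    exact integrableOn_const hTb.measure_lt_top.ne
  · have hC0 : 0 ≤ C := (norm_nonneg _).trans (hC 0)
    have hd1 : dist t t ≤ r := by rw [dist_self]; exact (norm_nonneg s).trans hr
    have hd2 : dist t (t + s) ≤ r := by simpa using hr
    have hT0 : 0 ≤ T.indicator (fun _ => C) t := Set.indicator_nonneg (fun _ _ => hC0) t
    by_cases h1 : t + s ∈ A <;> by_cases h2 : t ∈ A
    · simpa [h1, h2] using hT0
    · have h3 : t ∈ T := mem_cthickening_frontier h1 h2 hd2 hd1
      simpa [h1, h2, h3] using hC t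
    · have h3 : t ∈ T := mem_cthickening_frontier h2 h1 hd1 hd2
      simpa [h1, h2, h3] using hC t
    · simpa [h1, h2] using hT0

/-- The distribution of `-t + Λ` for `t` uniformly distributed in `A`. -/
def orbitAverage (Λ : DeloneMultiset d m) (A : Set (E d)) : Measure (hull Λ) :=
  (ProbabilityTheory.cond volume A).map fun t : E d => -t +ᵥ hullBase Λ

lemma continuous_orbit (Λ : DeloneMultiset d m) :
    Continuous fun t : E d => -t +ᵥ hullBase Λ := by
  fun_prop

lemma isProbabilityMeasure_orbitAverage (Λ : DeloneMultiset d m) {A : Set (E d)}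
    (h0 : volume A ≠ 0) (hb : Bornology.IsBounded A) :
    IsProbabilityMeasure (orbitAverage Λ A) := by
  have := ProbabilityTheory.cond_isProbabilityMeasure_of_finite h0 hb.measure_lt_top.ne
  exact Measure.isProbabilityMeasure_map (continuous_orbit Λ).aemeasurable

lemma integral_orbitAverage (Λ : DeloneMultiset d m) (A : Set (E d)) (f : hull Λ →ᵇ ℝ) :
    ∫ Γ, f Γ ∂(orbitAverage Λ A) =
      (volume.real A)⁻¹ * ∫ t in A, f (-t +ᵥ hullBase Λ) := by
  rw [orbitAverage, integral_map (continuous_orbit Λ).aemeasurable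
    f.continuous.aestronglyMeasurable, ProbabilityTheory.cond, integral_smul_measure,
    ENNReal.toReal_inv, smul_eq_mul, measureReal_def]

/-- Krylov-Bogoliubov: a cluster point of the averages along the orbit of `Λ` over a van Hove
sequence is invariant. -/
lemma exists_invariantProb {Λ : DeloneMultiset d m} [CompactSpace (hull Λ)]
    {F : ℕ → Set (E d)} (hF : IsVanHove F) : ∃ μ : Measure (hull Λ), IsInvariantProb Λ μ := by
  set M : ℕ → ProbabilityMeasure (hull Λ) := fun n => ⟨orbitAverage Λ (F n),
    isProbabilityMeasure_orbitAverage Λ (hF.volume_pos n).ne' (hF.isBounded n)⟩ with hM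
  obtain ⟨μ, -, hμ⟩ := (isCompact_univ (X := ProbabilityMeasure (hull Λ))).ultrafilter_le_nhds
    ((hyperfilter ℕ).map M) (by simp)
  have hlim : Tendsto M (hyperfilter ℕ : Filter ℕ) (𝓝 μ) := hμ
  rw [ProbabilityMeasure.tendsto_iff_forall_integral_tendsto] at hlim
  have hle : (hyperfilter ℕ : Filter ℕ) ≤ atTop := by
    rw [← Nat.cofinite_eq_atTop]; exact hyperfilter_le_cofinite
  have hpos : ∀ n, 0 < volume.real (F n) := fun n =>
    ENNReal.toReal_pos (hF.volume_pos n).ne' (hF.isBounded n).measure_lt_top.ne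
  refine ⟨μ, inferInstance, ⟨fun s A hA => ?_⟩⟩
  have hs : Continuous fun Γ : hull Λ => s +ᵥ Γ := continuous_const_vadd s
  suffices h : (μ : Measure (hull Λ)).map (fun Γ => s +ᵥ Γ) = μ by
    conv_rhs => rw [← h]
    rw [Measure.map_apply hs.measurable hA]
  have := Measure.isProbabilityMeasure_map (μ := (μ : Measure (hull Λ))) hs.aemeasurable
  refine ext_of_forall_integral_eq_of_IsFiniteMeasure fun f => ?_
  rw [integral_map hs.aemeasurable f.continuous.aestronglyMeasurable]
  set fs : hull Λ →ᵇ ℝ := f.compContinuous ⟨_, hs⟩ with hfs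
  have h1 := hlim fs
  have h2 := hlim f
  refine tendsto_nhds_unique h1 (tendsto_of_tendsto_of_dist h2 (squeeze_zero
    (fun _ => dist_nonneg) (fun n => ?_) (?_ : Tendsto (fun n => ‖f‖ *
      (volume.real (Metric.cthickening (‖s‖ + 1) (frontier (F n))) / volume.real (F n)))
        (hyperfilter ℕ : Filter ℕ) (𝓝 0))))
  · have hb := norm_setIntegral_sub_translate_le
      (f := fun t => f (-t +ᵥ hullBase Λ))
      (f.continuous.comp (continuous_orbit Λ)) (fun t => f.norm_coe_le_norm _)
      (hF.measurable n) (hF.isBounded n) s (le_add_of_nonneg_right zero_le_one)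
    have he : ∀ t : E d, fs (-t +ᵥ hullBase Λ) =
        f (-(t - s) +ᵥ hullBase Λ) := by
      intro t
      change f (s +ᵥ (-t +ᵥ _)) = _
      rw [← add_vadd, neg_sub, sub_eq_add_neg]
    change dist (∫ Γ, f Γ ∂(orbitAverage Λ (F n))) (∫ Γ, fs Γ ∂(orbitAverage Λ (F n))) ≤ _
    rw [dist_comm, integral_orbitAverage, integral_orbitAverage, Real.dist_eq, ← mul_sub, abs_mul,
      abs_of_pos (inv_pos.mpr (hpos n)), ← mul_div_assoc, div_eq_inv_mul]
    simp only [he]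
    exact mul_le_mul_of_nonneg_left hb (inv_pos.mpr (hpos n)).le
  · have h3 := (ENNReal.tendsto_toReal ENNReal.zero_ne_top).comp
      (hF.tendsto (‖s‖ + 1) (by positivity))
    have h4 : Tendsto (fun n => volume.real (Metric.cthickening (‖s‖ + 1) (frontier (F n))) /
        volume.real (F n)) atTop (𝓝 0) := by
      simpa [Function.comp_def, ENNReal.toReal_div, measureReal_def] using h3
    simpa using (h4.mono_left hle).const_mul ‖f‖

end DeloneDyn

end

theorem corollary2p3 (d m : ℕ) (Λ : DeloneDyn.DeloneMultiset d m) (F : ℕ → Set (DeloneDyn.E d))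
    (hF : DeloneDyn.IsVanHove F) (hFLC : DeloneDyn.HasFLC Λ) (hUCF : DeloneDyn.HasUCF F Λ) :
    ∃ μ : Measure (DeloneDyn.hull Λ), DeloneDyn.IsInvariantProb Λ μ ∧
      (∀ ν : Measure (DeloneDyn.hull Λ), DeloneDyn.IsInvariantProb Λ ν → ν = μ) ∧
      ∀ η : ℝ, 0 < η →
        (∀ z : DeloneDyn.E d, (Λ.supp ∩ Metric.closedBall z (η / 2)).Subsingleton) →
        ∀ P : Fin m → Set (DeloneDyn.E d), DeloneDyn.IsCluster P Λ → (∃ i, (P i).Nonempty) →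
        ∀ V : Set (DeloneDyn.E d), MeasurableSet V → Metric.ediam V < ENNReal.ofReal η →
          MeasurableSet (DeloneDyn.cylinder Λ P V) ∧
          μ.real (DeloneDyn.cylinder Λ P V) = volume.real V * DeloneDyn.freq F Λ P := by
  have := DeloneDyn.compactSpace_hull hFLC
  obtain ⟨μ, hμ⟩ := DeloneDyn.exists_invariantProb (Λ := Λ) hF
  refine ⟨μ, hμ, fun ν hν => DeloneDyn.invariantProb_unique hF hUCF hν hμ, ?_⟩
  intro η _ hη P hP hne V hV hVη
  refine ⟨DeloneDyn.measurableSet_cylinder hη hne hV hVη, ?_⟩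
  have hfreq : 0 ≤ DeloneDyn.freq F Λ P := by
    have h := (hUCF P hP hne).tendsto_at 0
    exact ge_of_tendsto' h fun n => by positivity
  rw [measureReal_def, DeloneDyn.measure_cylinder hF hUCF hμ hη hP hne hV hVη,
    ENNReal.toReal_ofReal (mul_nonneg measureReal_nonneg hfreq)]
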